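/- Let $V$ and $H$ be real separable Hilbert spaces, $V$ compactly and densely embedded in $H$, and let $C_{V,H}>0$ satisfy $\|v\|_H\le C_{V,H}\|v\|_V$ for all $v\in V$. Identify $H$ with its dual, so that $V\subset H\subset V^*$. For Hilbert spaces $X,Y$ let $HS(X,Y)$ be the Hilbert space of Hilbert–Schmidt operators $X\to Y$. Put $\mathcal H=HS(H,H)$, with norm $\|\cdot\|$, and $\mathcal V=HS(V^*,H)\cap HS(H,V)$, with $\|P\|_{\mathcal V}^2=\|P\|_{HS(V^*,H)}^2+\|P\|_{HS(H,V)}^2$; let $\mathcal V^*=HS(V,H)+HS(H,V^*)$ be the dual of $\mathcal V$ with the dual norm, the pairing extending the inner product of $\mathcal H$, so that $\mathcal V\subset\mathcal H\subset\mathcal V^*$. For a self-adjoint $P\in\mathcal H$ and $c\in\mathbb R$, $P\ge c$ means $(Pu,u)_H\ge c\|u\|_H^2$ for all $u\in H$. Let $T>0$ and let $a:[0,T]\times V\times V\to\mathbb R$ be such that each $a(t;\cdot,\cdot)$ is bilinear, $a(\cdot;u,v)$ is Lebesgue measurable for all $u,v\in V$, and, with constants $\mu,\eta>0$, $a(t;u,u)\ge\mu\|u\|_V^2$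 and $|a(t;u,v)|\le\eta\|u\|_V\|v\|_V$ for all $t\in[0,T]$ and $u,v\in V$. Let $N\ge1$, $\tau=T/N$, $t_n=n\tau$, and assume $\tau<\frac{\mu}{2C_{V,H}^2}$. Let $0\le\gamma<\frac{\mu}{C_{V,H}^2}$. Let $\mathcal Q\in L^2(0,T;\mathcal H)$ with $\mathcal Q(t)=\mathcal Q(t)^*$ and $\mathcal Q(t)\ge-\gamma^2$ for almost every $t\in[0,T]$, and let $P_0\in\mathcal H$ with $P_0=P_0^*$ and $P_0\ge-\gamma$. For $n=1,\dots,N$ let $Q_n=\frac1\tau\int_{t_{n-1}}^{t_n}\mathcal Q(t)\,dt\in\mathcal H$, let $A_n:V\to V^*$ be given by $\langle A_nu,v\rangle=\frac1\tau\int_{t_{n-1}}^{t_n}a(t;u,v)\,dt$, and let $A_n^*:V\to V^*$ be its dual operator, $\langle A_n^*u,v\rangle=\langle A_nv,u\rangle$. Then there are self-adjoint $P_1,\dots,P_N\in\mathcal V$ with $P_n\ge-\gamma$ such that $$\frac{P_n-P_{n-1}}{\tau}+A_n^*P_n+P_nA_n+P_n^2=Q_n\quad\text{in }\mathcal V^*,\qquad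 n=1,\dots,N,$$ and such that, for $n=1,\dots,N$, $$\|P_n\|^2+\sum_{k=1}^n\|P_k-P_{k-1}\|^2+\Big(\mu-\frac{\gamma C_{V,H}^2}{2}\Big)\tau\sum_{k=1}^n\|P_k\|_{\mathcal V}^2\le\|P_0\|^2+\frac{1}{\mu-\frac{\gamma C_{V,H}^2}{2}}\int_0^T\|\mathcal Q(t)\|_{\mathcal V^*}^2\,dt.$$ -/

import Mathlib

open MeasureTheory Set Topology
open scoped InnerProductSpace ENNReal

set_option linter.unusedSectionVars false

noncomputable section

namespace Riccati

/-! ### Hilbert-Schmidt operators between real Hilbert spaces -/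

section HilbertSchmidt

variable (X Y Z : Type*)
  [NormedAddCommGroup X] [InnerProductSpace ℝ X] [CompleteSpace X]
  [NormedAddCommGroup Y] [InnerProductSpace ℝ Y] [CompleteSpace Y]
  [NormedAddCommGroup Z] [InnerProductSpace ℝ Z] [CompleteSpace Z]

/-- The index set of a fixed orthonormal basis of `X`. -/
def basisIndex : Set X := (exists_hilbertBasis ℝ X).choose

/-- A fixed orthonormal basis of `X`. The notions below do not depend on this choice, see
`HS.hasSum_sq`, `HS.hasSum_inner` and `isHilbertSchmidt_iff`. -/
def stdBasis : HilbertBasis (basisIndex X) ℝ X := (exists_hilbertBasis ℝ X).choose_spec.choose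

variable {X Y Z}

/-- `T` is a Hilbert-Schmidt operator: `∑ ‖T e_i‖²` is finite for an orthonormal basis `(e_i)`. -/
def IsHilbertSchmidt (T : X →L[ℝ] Y) : Prop :=
  Summable fun i => ‖T (stdBasis X i)‖ ^ 2

theorem tsum_sq_basis {κ : Type*} (b : HilbertBasis κ ℝ X) (x : X) :
    ∑' i, ENNReal.ofReal (⟪b i, x⟫_ℝ ^ 2) = ENNReal.ofReal (‖x‖ ^ 2) := by
  have h := b.hasSum_inner_mul_inner x x
  have h2 : HasSum (fun i => ⟪b i, x⟫_ℝ ^ 2) (‖x‖ ^ 2) := by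
    rw [← real_inner_self_eq_norm_sq]
    refine h.congr_fun ?_ |> fun h => h
    intro i
    rw [real_inner_comm (b i) x, sq]
  rw [← h2.tsum_eq, ENNReal.ofReal_tsum_of_nonneg (fun i => sq_nonneg _) h2.summable]

theorem tsum_sq_adjoint {κ κ' : Type*} (b : HilbertBasis κ ℝ X) (c : HilbertBasis κ' ℝ Y)
    (T : X →L[ℝ] Y) :
    ∑' i, ENNReal.ofReal (‖T (b i)‖ ^ 2)
      = ∑' j, ENNReal.ofReal (‖ContinuousLinearMap.adjoint T (c j)‖ ^ 2) := by
  calc ∑' i, ENNReal.ofReal (‖T (b i)‖ ^ 2)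
      = ∑' i, ∑' j, ENNReal.ofReal (⟪c j, T (b i)⟫_ℝ ^ 2) := by
        simp_rw [tsum_sq_basis c]
    _ = ∑' j, ∑' i, ENNReal.ofReal (⟪c j, T (b i)⟫_ℝ ^ 2) := ENNReal.tsum_comm
    _ = ∑' j, ∑' i, ENNReal.ofReal (⟪b i, ContinuousLinearMap.adjoint T (c j)⟫_ℝ ^ 2) := by
        simp_rw [ContinuousLinearMap.adjoint_inner_right, real_inner_comm]
    _ = _ := by simp_rw [tsum_sq_basis b]

theorem tsum_sq_indep {κ κ' : Type*} (b : HilbertBasis κ ℝ X) (b' : HilbertBasis κ' ℝ X)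
    (T : X →L[ℝ] Y) :
    ∑' i, ENNReal.ofReal (‖T (b i)‖ ^ 2) = ∑' i, ENNReal.ofReal (‖T (b' i)‖ ^ 2) := by
  rw [tsum_sq_adjoint b (stdBasis Y), tsum_sq_adjoint b' (stdBasis Y)]

theorem summable_sq_iff {κ : Type*} (f : κ → Y) :
    Summable (fun i => ‖f i‖ ^ 2) ↔ ∑' i, ENNReal.ofReal (‖f i‖ ^ 2) ≠ ∞ := by
  constructor
  · intro h
    rw [← ENNReal.ofReal_tsum_of_nonneg (fun i => sq_nonneg _) h]
    exact ENNReal.ofReal_ne_top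
  · intro h
    have := ENNReal.summable_toReal h
    simpa [ENNReal.toReal_ofReal, sq_nonneg] using this

/-- The Hilbert-Schmidt property can be tested on every orthonormal basis. -/
theorem isHilbertSchmidt_iff {κ : Type*} (b : HilbertBasis κ ℝ X) (T : X →L[ℝ] Y) :
    IsHilbertSchmidt T ↔ Summable fun i => ‖T (b i)‖ ^ 2 := by
  unfold IsHilbertSchmidt
  rw [summable_sq_iff (fun i => T (stdBasis X i)), summable_sq_iff (fun i => T (b i)),
    tsum_sq_indep b (stdBasis X)]

theorem IsHilbertSchmidt.memℓp {T : X →L[ℝ] Y} (hT : IsHilbertSchmidt T) :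
    Memℓp (fun i => T (stdBasis X i)) 2 := by
  apply memℓp_gen
  simpa [IsHilbertSchmidt] using hT

theorem isHilbertSchmidt_of_memℓp {T : X →L[ℝ] Y}
    (hT : Memℓp (fun i => T (stdBasis X i)) 2) : IsHilbertSchmidt T := by
  have := hT.summable (by norm_num)
  simpa [IsHilbertSchmidt] using this

variable (X Y) in
/-- The linear space of Hilbert-Schmidt operators as a subspace of all bounded operators. -/
def hsSubmodule : Submodule ℝ (X →L[ℝ] Y) where
  carrier := {T | IsHilbertSchmidt T}
  zero_mem' := by simp [IsHilbertSchmidt, summable_zero]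
  add_mem' := fun {S T} hS hT => isHilbertSchmidt_of_memℓp (hS.memℓp.add hT.memℓp)
  smul_mem' := fun c T hT => isHilbertSchmidt_of_memℓp (hT.memℓp.const_smul c)

variable (X Y) in
/-- The space `HS(X, Y)` of Hilbert-Schmidt operators. It is a type of its own since it carries
the Hilbert-Schmidt norm and not the operator norm. -/
def HS : Type _ := hsSubmodule X Y

instance : AddCommGroup (HS X Y) := inferInstanceAs (AddCommGroup (hsSubmodule X Y))
instance : Module ℝ (HS X Y) := inferInstanceAs (Module ℝ (hsSubmodule X Y))

namespace HS

/-- The bounded operator underlying a Hilbert-Schmidt operator. -/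
def op : HS X Y →ₗ[ℝ] (X →L[ℝ] Y) := (hsSubmodule X Y).subtype

theorem op_injective : Function.Injective (op : HS X Y →ₗ[ℝ] (X →L[ℝ] Y)) :=
  Subtype.val_injective

theorem isHilbertSchmidt (T : HS X Y) : IsHilbertSchmidt T.op := T.2

/-- A bounded operator with the Hilbert-Schmidt property, as an element of `HS(X, Y)`. -/
def mk (T : X →L[ℝ] Y) (hT : IsHilbertSchmidt T) : HS X Y := ⟨T, hT⟩

@[simp] theorem op_mk (T : X →L[ℝ] Y) (hT : IsHilbertSchmidt T) : (mk T hT).op = T := rfl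

theorem summable_inner (T S : HS X Y) :
    Summable fun i => ⟪T.op (stdBasis X i), S.op (stdBasis X i)⟫_ℝ :=
  lp.summable_inner (𝕜 := ℝ) (G := fun _ : basisIndex X => Y)
    ⟨_, T.isHilbertSchmidt.memℓp⟩ ⟨_, S.isHilbertSchmidt.memℓp⟩

/-- The Hilbert-Schmidt inner product `∑ ⟨T e_i, S e_i⟩`. -/
abbrev core : InnerProductSpace.Core ℝ (HS X Y) where
  inner T S := ∑' i, ⟪T.op (stdBasis X i), S.op (stdBasis X i)⟫_ℝ
  conj_inner_symm T S := by
    simp only [conj_trivial]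
    exact tsum_congr fun i => real_inner_comm _ _
  re_inner_nonneg T := by
    simp only [RCLike.re_to_real]
    exact tsum_nonneg fun i => real_inner_self_nonneg
  add_left R S T := by
    simp only [map_add, add_apply, inner_add_left]
    exact (summable_inner R T).tsum_add (summable_inner S T)
  smul_left S T r := by
    simp only [map_smul, smul_apply, inner_smul_left, conj_trivial]
    exact tsum_mul_left
  definite T hT := by
    have h0 : ∀ i, ⟪T.op (stdBasis X i), T.op (stdBasis X i)⟫_ℝ = 0 := by
      have h := (summable_inner T T).hasSum
      rw [show ∑' i, ⟪T.op (stdBasis X i), T.op (stdBasis X i)⟫_ℝ = 0 from hT] at h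
      exact fun i => congrFun ((hasSum_zero_iff_of_nonneg
        (fun i => real_inner_self_nonneg)).1 h) i
    apply op_injective
    rw [map_zero]
    refine ContinuousLinearMap.ext_on (s := range (stdBasis X)) ?_ ?_
    · have := (stdBasis X).dense_span
      rwa [← Submodule.dense_iff_topologicalClosure_eq_top] at this
    · rintro _ ⟨i, rfl⟩
      simpa using h0 i

instance : NormedAddCommGroup (HS X Y) := core.toNormedAddCommGroup
instance : InnerProductSpace ℝ (HS X Y) := InnerProductSpace.ofCore core.toCore

theorem inner_def (T S : HS X Y) :
    ⟪T, S⟫_ℝ = ∑' i, ⟪T.op (stdBasis X i), S.op (stdBasis X i)⟫_ℝ := rfl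

theorem norm_sq_def (T : HS X Y) : ‖T‖ ^ 2 = ∑' i, ‖T.op (stdBasis X i)‖ ^ 2 := by
  rw [← real_inner_self_eq_norm_sq, inner_def]
  simp_rw [real_inner_self_eq_norm_sq]

/-- `‖T‖² = ∑ ‖T e_i‖²` for every orthonormal basis `(e_i)`. -/
theorem hasSum_sq {κ : Type*} (b : HilbertBasis κ ℝ X) (T : HS X Y) :
    HasSum (fun i => ‖T.op (b i)‖ ^ 2) (‖T‖ ^ 2) := by
  have h1 := (isHilbertSchmidt_iff b T.op).1 T.isHilbertSchmidt
  have h2 := T.isHilbertSchmidt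
  have h3 := tsum_sq_indep b (stdBasis X) T.op
  rw [← ENNReal.ofReal_tsum_of_nonneg (fun i => sq_nonneg _) h1,
    ← ENNReal.ofReal_tsum_of_nonneg (fun i => sq_nonneg _) h2,
    ENNReal.ofReal_eq_ofReal_iff (tsum_nonneg fun i => sq_nonneg _)
      (tsum_nonneg fun i => sq_nonneg _)] at h3
  rw [norm_sq_def, ← h3]
  exact h1.hasSum

/-- `⟨T, S⟩ = ∑ ⟨T e_i, S e_i⟩` for every orthonormal basis `(e_i)`. -/
theorem hasSum_inner {κ : Type*} (b : HilbertBasis κ ℝ X) (T S : HS X Y) :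
    HasSum (fun i => ⟪T.op (b i), S.op (b i)⟫_ℝ) ⟪T, S⟫_ℝ := by
  have h := (((hasSum_sq b (T + S)).sub (hasSum_sq b (T - S)))).div_const 4
  have e : (‖T + S‖ ^ 2 - ‖T - S‖ ^ 2) / 4 = ⟪T, S⟫_ℝ := by
    rw [norm_add_sq_real, norm_sub_sq_real]; ring
  rw [e] at h
  have hf : (fun i => ⟪T.op (b i), S.op (b i)⟫_ℝ)
      = fun i => (‖(T + S).op (b i)‖ ^ 2 - ‖(T - S).op (b i)‖ ^ 2) / 4 := by
    funext i
    rw [map_add, map_sub, add_apply, sub_apply, norm_add_sq_real, norm_sub_sq_real]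
    ring
  rw [hf]
  exact h

theorem norm_op_apply_le (T : HS X Y) (x : X) : ‖T.op x‖ ≤ ‖T‖ * ‖x‖ := by
  rcases eq_or_ne x 0 with rfl | hx
  · simp
  have hx' : ‖x‖ ≠ 0 := norm_ne_zero_iff.2 hx
  set e : X := ‖x‖⁻¹ • x with he
  have hne : ‖e‖ = 1 := by rw [he, norm_smul, norm_inv, norm_norm, inv_mul_cancel₀ hx']
  have horth : Orthonormal ℝ ((↑) : ({e} : Set X) → X) := by
    refine ⟨?_, ?_⟩
    · rintro ⟨v, hv⟩
      rw [mem_singleton_iff] at hv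
      subst hv
      exact hne
    · rintro ⟨v, hv⟩ ⟨w, hw⟩ hvw
      exact absurd (Subtype.ext ((mem_singleton_iff.1 hv).trans (mem_singleton_iff.1 hw).symm)) hvw
  obtain ⟨w, b, hw, hb⟩ := horth.exists_hilbertBasis_extension
  have hmem : e ∈ w := hw rfl
  have hle := le_hasSum (hasSum_sq b T) ⟨e, hmem⟩ (fun _ _ => sq_nonneg _)
  rw [hb] at hle
  have h1 : ‖T.op e‖ ≤ ‖T‖ := le_of_sq_le_sq hle (norm_nonneg _)
  have h2 : x = ‖x‖ • e := by rw [he, smul_smul, mul_inv_cancel₀ hx', one_smul]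
  calc ‖T.op x‖ = ‖x‖ * ‖T.op e‖ := by
        conv_lhs => rw [h2]
        rw [map_smul, norm_smul, norm_norm]
    _ ≤ ‖T‖ * ‖x‖ := by rw [mul_comm]; gcongr

theorem norm_op_le (T : HS X Y) : ‖T.op‖ ≤ ‖T‖ :=
  ContinuousLinearMap.opNorm_le_bound _ (norm_nonneg _) T.norm_op_apply_le

/-- The values of a Hilbert-Schmidt operator on the fixed basis. -/
def coords (T : HS X Y) : lp (fun _ : basisIndex X => Y) 2 := ⟨_, T.isHilbertSchmidt.memℓp⟩

theorem norm_coords_sub (T S : HS X Y) : ‖coords T - coords S‖ = ‖T - S‖ := by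
  have h : ‖coords T - coords S‖ ^ 2 = ‖T - S‖ ^ 2 := by
    rw [norm_sq_def, ← real_inner_self_eq_norm_sq, lp.inner_eq_tsum]
    refine tsum_congr fun i => ?_
    rw [← real_inner_self_eq_norm_sq, map_sub, sub_apply]
    rfl
  exact (sq_eq_sq₀ (norm_nonneg _) (norm_nonneg _)).1 h

instance : CompleteSpace (HS X Y) := by
  refine Metric.complete_of_cauchySeq_tendsto fun u hu => ?_
  rw [Metric.cauchySeq_iff'] at hu
  have hop : CauchySeq fun n => (u n).op := by
    rw [Metric.cauchySeq_iff']
    intro ε hε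
    obtain ⟨N, hN⟩ := hu ε hε
    refine ⟨N, fun n hn => ?_⟩
    rw [dist_eq_norm, ← map_sub]
    refine (norm_op_le _).trans_lt ?_
    rw [← dist_eq_norm]
    exact hN n hn
  have hco : CauchySeq fun n => coords (u n) := by
    rw [Metric.cauchySeq_iff']
    intro ε hε
    obtain ⟨N, hN⟩ := hu ε hε
    refine ⟨N, fun n hn => ?_⟩
    rw [dist_eq_norm, norm_coords_sub, ← dist_eq_norm]
    exact hN n hn
  obtain ⟨T, hT⟩ := cauchySeq_tendsto_of_complete hop
  obtain ⟨y, hy⟩ := cauchySeq_tendsto_of_complete hco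
  have hval : ∀ i, T (stdBasis X i) = y i := by
    intro i
    have h1 : Filter.Tendsto (fun n => (u n).op (stdBasis X i)) Filter.atTop
        (𝓝 (T (stdBasis X i))) :=
      ((ContinuousLinearMap.apply ℝ Y (stdBasis X i)).continuous.tendsto T).comp hT
    have h2 : Filter.Tendsto (fun n => coords (u n) i) Filter.atTop (𝓝 (y i)) := by
      rw [tendsto_iff_norm_sub_tendsto_zero] at hy ⊢
      refine squeeze_zero (fun _ => norm_nonneg _) (fun n => ?_) hy
      exact lp.norm_apply_le_norm (by norm_num) (coords (u n) - y) i
    exact tendsto_nhds_unique h1 h2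
  have hTHS : IsHilbertSchmidt T := by
    apply isHilbertSchmidt_of_memℓp
    rw [show (fun i => T (stdBasis X i)) = y from funext hval]
    exact y.2
  refine ⟨mk T hTHS, ?_⟩
  have hc : coords (mk T hTHS) = y := by
    ext i
    exact hval i
  rw [tendsto_iff_norm_sub_tendsto_zero] at hy ⊢
  rw [← hc] at hy
  simpa only [norm_coords_sub] using hy

theorem isHilbertSchmidt_comp (L : Y →L[ℝ] Z) (T : HS X Y) :
    IsHilbertSchmidt (L ∘L T.op) := by
  refine Summable.of_nonneg_of_le (fun i => sq_nonneg _) (fun i => ?_)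
    (T.isHilbertSchmidt.mul_left (‖L‖ ^ 2))
  rw [← mul_pow]
  exact pow_le_pow_left₀ (norm_nonneg _) (L.le_opNorm _) 2

/-- `T ↦ L ∘ T` as a bounded map `HS(X, Y) → HS(X, Z)`, for a bounded operator `L : Y → Z`. -/
def compL (L : Y →L[ℝ] Z) : HS X Y →L[ℝ] HS X Z :=
  LinearMap.mkContinuous
    { toFun := fun T => mk (L ∘L T.op) (isHilbertSchmidt_comp L T)
      map_add' := fun S T => op_injective (by simp)
      map_smul' := fun c T => op_injective (by simp) }
    ‖L‖ (fun T => by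
      refine le_of_sq_le_sq ?_ (by positivity)
      rw [mul_pow, norm_sq_def, norm_sq_def, ← tsum_mul_left]
      refine Summable.tsum_le_tsum (fun i => ?_) (isHilbertSchmidt_comp L T)
        (T.isHilbertSchmidt.mul_left (‖L‖ ^ 2))
      rw [← mul_pow]
      exact pow_le_pow_left₀ (norm_nonneg _) (L.le_opNorm _) 2)

@[simp] theorem op_compL (L : Y →L[ℝ] Z) (T : HS X Y) : (compL L T).op = L ∘L T.op := rfl

end HS

end HilbertSchmidt

/-! ### The Hilbert space structure of the dual space -/

section Dual

variable {V : Type*} [NormedAddCommGroup V] [InnerProductSpace ℝ V] [CompleteSpace V]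

/-- The dual `V*` of a real Hilbert space, with its usual dual norm, is a Hilbert space; its inner
product is carried over by the Riesz isomorphism. -/
instance dualInnerProductSpace : InnerProductSpace ℝ (StrongDual ℝ V) where
  inner f g := ⟪(InnerProductSpace.toDual ℝ V).symm f, (InnerProductSpace.toDual ℝ V).symm g⟫_ℝ
  norm_sq_eq_re_inner f := by simp
  conj_inner_symm f g := by
    rw [conj_trivial]
    exact real_inner_comm _ _
  add_left f g h := by simp [inner_add_left]
  smul_left f g r := by simp [inner_smul_left]

end Dual

/-! ### The Gelfand triples -/

section Gelfand

variable {V H : Type*}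
  [NormedAddCommGroup V] [InnerProductSpace ℝ V] [CompleteSpace V]
  [NormedAddCommGroup H] [InnerProductSpace ℝ H] [CompleteSpace H]

/-- `ι` embeds `V` compactly and densely into `H`. -/
structure IsCompactDenseEmbedding (ι : V →L[ℝ] H) : Prop where
  injective : Function.Injective ι
  denseRange : DenseRange ι
  compact : IsCompactOperator ι

/-- The embedding `H ≅ H* → V*`, `h ↦ ⟨h, ι ·⟩`, of the Gelfand triple `V ⊆ H ⊆ V*`. -/
def pivot (ι : V →L[ℝ] H) : H →L[ℝ] StrongDual ℝ V :=
  LinearMap.mkContinuous₂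
    (LinearMap.mk₂ ℝ (fun (h : H) (v : V) => ⟪h, ι v⟫_ℝ)
      (fun h h' v => inner_add_left _ _ _)
      (fun c h v => by simp [inner_smul_left])
      (fun h v v' => by simp [inner_add_right])
      (fun c h v => by simp [inner_smul_right]))
    ‖ι‖ (fun h v => by
      refine (norm_inner_le_norm _ _).trans ?_
      calc ‖h‖ * ‖ι v‖ ≤ ‖h‖ * (‖ι‖ * ‖v‖) := by gcongr; exact ι.le_opNorm v
        _ = ‖ι‖ * ‖h‖ * ‖v‖ := by ring)

@[simp] theorem pivot_apply (ι : V →L[ℝ] H) (h : H) (v : V) : pivot ι h v = ⟪h, ι v⟫_ℝ := rfl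

/-- The Hilbert space `𝒱 = HS(V*, H) ∩ HS(H, V)`: pairs of an operator `L ∈ HS(V*, H)` and an
operator `R ∈ HS(H, V)` that are one and the same operator, that is, they agree as operators
`H → H` after the embeddings `H → V*` and `V → H`. The inner product of `𝒱` is the sum of the two
Hilbert-Schmidt inner products. -/
def opV (ι : V →L[ℝ] H) : Submodule ℝ (WithLp 2 (HS (StrongDual ℝ V) H × HS H V)) where
  carrier := {P | P.fst.op ∘L pivot ι = ι ∘L P.snd.op}
  zero_mem' := by simp
  add_mem' := fun {P R} hP hR => by
    simp only [mem_ofPred_eq, WithLp.add_fst, WithLp.add_snd, map_add,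
      ContinuousLinearMap.add_comp, ContinuousLinearMap.comp_add] at hP hR ⊢
    rw [hP, hR]
  smul_mem' := fun c P hP => by
    simp only [mem_ofPred_eq, WithLp.smul_fst, WithLp.smul_snd, map_smul,
      ContinuousLinearMap.smul_comp, ContinuousLinearMap.comp_smul] at hP ⊢
    rw [hP]

variable {ι : V →L[ℝ] H}

/-- An element of `𝒱` as an operator `V* → H`. -/
def leftOp (P : opV ι) : StrongDual ℝ V →L[ℝ] H := P.1.fst.op

/-- An element of `𝒱` as an operator `H → V`. -/
def rightOp (P : opV ι) : H →L[ℝ] V := P.1.snd.op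

theorem norm_sq_opV (P : opV ι) : ‖P‖ ^ 2 = ‖P.1.fst‖ ^ 2 + ‖P.1.snd‖ ^ 2 :=
  WithLp.prod_norm_sq_eq_of_L2 P.1

variable (ι) in
/-- The embedding of `𝒱` into `HS(H, H)`. -/
def inclHS : opV ι →L[ℝ] HS H H :=
  HS.compL ι ∘L WithLp.sndL 2 ℝ (HS (StrongDual ℝ V) H) (HS H V) ∘L (opV ι).subtypeL

theorem op_inclHS (P : opV ι) : (inclHS ι P).op = ι ∘L rightOp P := rfl

theorem op_inclHS' (P : opV ι) : (inclHS ι P).op = leftOp P ∘L pivot ι := P.2.symm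

variable (ι) in
/-- The embedding of `HS(H, H)` into the dual space `𝒱*` of `𝒱`, `Q ↦ (S ↦ ⟨Q, S⟩)`. The norm of
the target is the dual norm of `𝒱*`. -/
def toDualV (Q : HS H H) : StrongDual ℝ (opV ι) := innerSL ℝ Q ∘L inclHS ι

@[simp] theorem toDualV_apply (Q : HS H H) (S : opV ι) :
    toDualV ι Q S = ⟪Q, inclHS ι S⟫_ℝ := rfl

/-- The set `C_c` of all self-adjoint `P ∈ HS(H, H)` with `P ≥ c`, that is, with
`⟨P u, u⟩ ≥ c ‖u‖²` for all `u ∈ H`. -/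
def lowerBounded (H : Type*) [NormedAddCommGroup H] [InnerProductSpace ℝ H] [CompleteSpace H]
    (c : ℝ) : Set (HS H H) :=
  {P | IsSelfAdjoint P.op ∧ ∀ u : H, c * ‖u‖ ^ 2 ≤ ⟪P.op u, u⟫_ℝ}

variable (ι) in
/-- A bounded operator `H → H`, viewed as an operator `V → V*` by means of the Gelfand triple. -/
def asVtoDual (S : H →L[ℝ] H) : V →L[ℝ] StrongDual ℝ V := pivot ι ∘L S ∘L ι

end Gelfand

/-! ### The bilinear forms and the backward Euler scheme -/

section Scheme

variable {V H : Type*}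
  [NormedAddCommGroup V] [InnerProductSpace ℝ V] [CompleteSpace V]
  [NormedAddCommGroup H] [InnerProductSpace ℝ H] [CompleteSpace H]

/-- `a(t; ·, ·)`, `t ∈ [0, T]`, are bilinear forms on `V` that are uniformly strongly positive with
constant `μ > 0`, uniformly bounded with constant `η > 0`, and Lebesgue measurable in `t`. -/
structure IsUniformForm (T μ η : ℝ) (a : ℝ → V →ₗ[ℝ] V →ₗ[ℝ] ℝ) : Prop where
  mu_pos : 0 < μ
  eta_pos : 0 < η
  coercive : ∀ t ∈ Icc 0 T, ∀ u : V, μ * ‖u‖ ^ 2 ≤ a t u u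
  bounded : ∀ t ∈ Icc 0 T, ∀ u v : V, |a t u v| ≤ η * ‖u‖ * ‖v‖
  measurable : ∀ u v : V, AEMeasurable (fun t => a t u v) (volume.restrict (Icc 0 T))

/-- The step size `τ = T / N`. -/
def stepSize (T : ℝ) (N : ℕ) : ℝ := T / N

/-- The grid points `t_n = n τ`. -/
def gridPoint (T : ℝ) (N n : ℕ) : ℝ := n * stepSize T N

theorem gridPoint_le {T : ℝ} (hT : 0 < T) (N n : ℕ) :
    gridPoint T N n ≤ gridPoint T N (n + 1) := by
  have : 0 ≤ stepSize T N := div_nonneg hT.le (Nat.cast_nonneg _)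
  unfold gridPoint
  gcongr
  simp

theorem grid_subset {T : ℝ} (hT : 0 < T) {N : ℕ} (n : Fin N) :
    Icc (gridPoint T N n) (gridPoint T N (n + 1)) ⊆ Icc 0 T := by
  have hN : (0 : ℝ) < N := by exact_mod_cast n.pos
  have h0 : 0 ≤ stepSize T N := div_nonneg hT.le hN.le
  refine Icc_subset_Icc (mul_nonneg (Nat.cast_nonneg _) h0) ?_
  have h1 : ((n + 1 : ℕ) : ℝ) ≤ N := by exact_mod_cast n.2
  calc gridPoint T N (n + 1) ≤ N * stepSize T N := by unfold gridPoint; gcongr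
    _ = T := by unfold stepSize; field_simp

theorem IsUniformForm.intervalIntegrable {T μ η : ℝ} {a : ℝ → V →ₗ[ℝ] V →ₗ[ℝ] ℝ}
    (ha : IsUniformForm T μ η a) (hT : 0 < T) {N : ℕ} (n : Fin N) (u v : V) :
    IntervalIntegrable (fun t => a t u v) volume
      (gridPoint T N n) (gridPoint T N (n + 1)) := by
  rw [intervalIntegrable_iff_integrableOn_Icc_of_le (gridPoint_le hT N n)]
  refine IntegrableOn.mono_set ?_ (grid_subset hT n)
  refine Integrable.of_bound (ha.measurable u v).aestronglyMeasurable (η * ‖u‖ * ‖v‖) ?_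
  filter_upwards [ae_restrict_mem measurableSet_Icc] with t ht
  exact ha.bounded t ht u v

/-- The averaged operator `A_{n+1} = τ⁻¹ ∫ A(t) dt` over `[t_n, t_{n+1}]`, for `0 ≤ n < N`, where
`⟨A(t) u, v⟩ = a(t; u, v)`: it is the operator `V → V*` with
`⟨A_{n+1} u, v⟩ = τ⁻¹ ∫ a(t; u, v) dt`. -/
def meanOperator {T μ η : ℝ} {a : ℝ → V →ₗ[ℝ] V →ₗ[ℝ] ℝ} (ha : IsUniformForm T μ η a)
    (hT : 0 < T) {N : ℕ} (n : Fin N) : V →L[ℝ] StrongDual ℝ V :=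
  LinearMap.mkContinuous₂
    (LinearMap.mk₂ ℝ
      (fun u v => (stepSize T N)⁻¹ * ∫ t in gridPoint T N n..gridPoint T N (n + 1), a t u v)
      (fun u u' v => by
        simp only [map_add, LinearMap.add_apply]
        rw [intervalIntegral.integral_add (ha.intervalIntegrable hT n u v)
          (ha.intervalIntegrable hT n u' v), mul_add])
      (fun c u v => by
        simp only [map_smul, LinearMap.smul_apply, smul_eq_mul,
          intervalIntegral.integral_const_mul]
        ring)
      (fun u v v' => by
        simp only [map_add]
        rw [intervalIntegral.integral_add (ha.intervalIntegrable hT n u v)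
          (ha.intervalIntegrable hT n u v'), mul_add])
      (fun c u v => by
        simp only [map_smul, smul_eq_mul, intervalIntegral.integral_const_mul]
        ring))
    η (fun u v => by
      have hN : (0 : ℝ) < N := by exact_mod_cast n.pos
      have hτ : 0 < stepSize T N := div_pos hT hN
      have hle := gridPoint_le hT N n
      have hlen : gridPoint T N (n + 1) - gridPoint T N n = stepSize T N := by
        unfold gridPoint; push_cast; ring
      have h := intervalIntegral.norm_integral_le_of_norm_le_const
        (f := fun t => a t u v) (a := gridPoint T N n) (b := gridPoint T N (n + 1))
        (C := η * ‖u‖ * ‖v‖) (fun t ht => ha.bounded t (grid_subset hT n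
          (Ioc_subset_Icc_self (by rwa [uIoc_of_le hle] at ht))) u v)
      rw [hlen, abs_of_pos hτ] at h
      rw [LinearMap.mk₂_apply, norm_mul, norm_inv, Real.norm_of_nonneg hτ.le,
        inv_mul_le_iff₀ hτ]
      linarith)

theorem meanOperator_apply {T μ η : ℝ} {a : ℝ → V →ₗ[ℝ] V →ₗ[ℝ] ℝ}
    (ha : IsUniformForm T μ η a) (hT : 0 < T) {N : ℕ} (n : Fin N) (u v : V) :
    meanOperator ha hT n u v =
      (stepSize T N)⁻¹ * ∫ t in gridPoint T N n..gridPoint T N (n + 1), a t u v := rfl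

/-- The averaged right-hand side `Q_{n+1} = τ⁻¹ ∫ Q(t) dt ∈ HS(H, H)` over `[t_n, t_{n+1}]`. -/
def meanRhs (T : ℝ) (N : ℕ) (Q : ℝ → HS H H) (n : ℕ) : HS H H :=
  (stepSize T N)⁻¹ • ∫ t in gridPoint T N n..gridPoint T N (n + 1), Q t

/-- One step `(P - P') / τ + A* P + P A + P² = Q` of the backward Euler scheme, for `P ∈ 𝒱` and
`P', Q ∈ HS(H, H)`. It is an equation in `𝒱* = HS(V, H) + HS(H, V*)`, whose elements are
operators `V → V*`; here `A*`, with `⟨A* u, v⟩ = ⟨A v, u⟩`, is the dual operator `A.flip`,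
the operator `A* P` is the composition `V → H → V → V*`, and `P A` is the composition
`V → V* → H → V*`. -/
def IsEulerStep (ι : V →L[ℝ] H) (τ : ℝ) (A : V →L[ℝ] StrongDual ℝ V) (Q P' : HS H H)
    (P : opV ι) : Prop :=
  τ⁻¹ • asVtoDual ι (inclHS ι P - P').op
      + (A.flip ∘L rightOp P ∘L ι + pivot ι ∘L leftOp P ∘L A
        + asVtoDual ι ((inclHS ι P).op ∘L (inclHS ι P).op))
    = asVtoDual ι Q.op

/-- The sequence `P_0, P_1, P_2, …` in `HS(H, H)` that starts with the given `P_0 ∈ HS(H, H)` and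
continues with `P_n ∈ 𝒱` for `n ≥ 1`. -/
def iterates {ι : V →L[ℝ] H} (P0 : HS H H) (P : ℕ → opV ι) : ℕ → HS H H
  | 0 => P0
  | n + 1 => inclHS ι (P (n + 1))

end Scheme

end Riccati

end

/-! Each Euler step is the stationary Riccati equation `σ P + A* P + P A + P² = Z` with `σ = 1/τ`
and `Z = Q_n + σ P_{n-1}`, so that `Z ≥ -(γ² + γ σ)`. It is solved by a fixed point that keeps the
bound `P ≥ -γ`. Adding `2β P` to both sides gives the linear Lyapunov equation `(σ + 2β) P + A* P +
P A = Z + 2β K - K²`, to be solved with `P = K`.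

The linear equation is solved by Lax–Milgram among the operators in `HS(H, V)` that are symmetric in
`H` (`exists_isLyapunovSolution`). By coercivity the solution operator has norm at most `1 / (σ + 2β
+ 2μ/C²)` on `HS(H, H)`. It also turns one-sided bounds on the data into one-sided bounds on the
solution. For this, an eigenvector of the compact symmetric operator `P` with nonzero eigenvalue
lies in `V`, and testing with it makes the equation scalar (`eigenvector`,
`lower_bound_of_eigenvalues`).

On `-γ ≤ K ≤ β` the map `K ↦ 2β K - K²` has Lipschitz constant `2β + 2γ` and is bounded below by
`-(2βγ + γ²)`. Since `γ < μ/C²`, for large `β` the fixed-point map preserves this closed set and is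
a contraction (`exists_riccati_solution`).

Testing the step with `P` itself gives the energy estimate. The only term of the wrong sign is `⟨P²,
P⟩ ≥ -γ ‖P‖²`, and the embedding bounds its loss by `(γ C²/2) ‖P‖²` in the norm of `𝒱`. Young's
inequality and summation over the steps finish the proof. -/

namespace Riccati

/-! ### Symmetric operators with a lower bound -/

section Symmetric

variable {H : Type*} [NormedAddCommGroup H] [InnerProductSpace ℝ H] [CompleteSpace H]

/-- A symmetric operator with `0 ≤ X ≤ c` satisfies `X² ≤ c X`. -/
theorem norm_apply_sq_le_of_bounds {X : H →L[ℝ] H} (hX : ∀ u v, ⟪X u, v⟫_ℝ = ⟪u, X v⟫_ℝ)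
    {c : ℝ} (hc : 0 < c) (h0 : ∀ u, 0 ≤ ⟪X u, u⟫_ℝ) (h1 : ∀ u, ⟪X u, u⟫_ℝ ≤ c * ‖u‖ ^ 2) (u : H) :
    ‖X u‖ ^ 2 ≤ c * ⟪X u, u⟫_ℝ := by
  -- Positivity at `(c - X) u` is the inequality `(c - X) X (c - X) ≥ 0`; its cubic term is
  -- controlled by `X ≤ c` at `X u`.
  have h2 := h0 (c • u - X u)
  have h3 := h1 (X u)
  have e : ⟪X (c • u - X u), c • u - X u⟫_ℝ
      = c ^ 2 * ⟪X u, u⟫_ℝ - 2 * c * ‖X u‖ ^ 2 + ⟪X (X u), X u⟫_ℝ := by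
    simp only [map_sub, map_smul, inner_sub_left, inner_sub_right, inner_smul_left,
      inner_smul_right, conj_trivial, hX (X u) u, real_inner_self_eq_norm_sq]
    ring
  rw [e] at h2
  have h4 : c * ‖X u‖ ^ 2 ≤ c * (c * ⟪X u, u⟫_ℝ) := by nlinarith
  exact le_of_mul_le_mul_left h4 hc

/-- A symmetric operator with `0 ≤ X ≤ c` has norm at most `c`. -/
theorem norm_le_of_bounds {X : H →L[ℝ] H} (hX : ∀ u v, ⟪X u, v⟫_ℝ = ⟪u, X v⟫_ℝ)
    {c : ℝ} (hc : 0 < c) (h0 : ∀ u, 0 ≤ ⟪X u, u⟫_ℝ) (h1 : ∀ u, ⟪X u, u⟫_ℝ ≤ c * ‖u‖ ^ 2) :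
    ‖X‖ ≤ c := by
  refine X.opNorm_le_bound hc.le fun u => ?_
  refine le_of_sq_le_sq ?_ (by positivity)
  have h2 := norm_apply_sq_le_of_bounds hX hc h0 h1 u
  have h3 := mul_le_mul_of_nonneg_left (h1 u) hc.le
  linarith [mul_pow c ‖u‖ 2]

/-- A compact symmetric operator is bounded below by every `c ≤ 0` that is a lower bound of
its eigenvalues. -/
theorem lower_bound_of_eigenvalues {K : H →L[ℝ] H} (hK : ∀ u v, ⟪K u, v⟫_ℝ = ⟪u, K v⟫_ℝ)
    (hcomp : IsCompactOperator K) {c : ℝ} (hc : c ≤ 0)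
    (heig : ∀ (l : ℝ) (e : H), e ≠ 0 → K e = l • e → c ≤ l) (u : H) :
    c * ‖u‖ ^ 2 ≤ ⟪K u, u⟫_ℝ := by
  by_contra! hu
  have hu0 : u ≠ 0 := by rintro rfl; simp at hu
  have hun : 0 < ‖u‖ ^ 2 := by positivity
  set S : Set ℝ := {m | ∀ v : H, m * ‖v‖ ^ 2 ≤ ⟪K v, v⟫_ℝ} with hS
  have habs : ∀ v : H, |⟪K v, v⟫_ℝ| ≤ ‖K‖ * ‖v‖ ^ 2 := fun v =>
    (abs_real_inner_le_norm _ _).trans (by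
      rw [sq, ← mul_assoc]; gcongr; exact K.le_opNorm v)
  have hne : S.Nonempty := ⟨-‖K‖, fun v => by linarith [neg_le_of_abs_le (habs v)]⟩
  have hlt : ∀ m ∈ S, m < c := fun m hm =>
    lt_of_mul_lt_mul_right ((hm u).trans_lt hu) hun.le
  have hbdd : BddAbove S := ⟨c, fun m hm => (hlt m hm).le⟩
  have hclosed : IsClosed S := by
    rw [hS, show {m : ℝ | ∀ v : H, m * ‖v‖ ^ 2 ≤ ⟪K v, v⟫_ℝ}
      = ⋂ v : H, {m : ℝ | m * ‖v‖ ^ 2 ≤ ⟪K v, v⟫_ℝ} by ext; simp]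
    exact isClosed_iInter fun v => isClosed_le (by fun_prop) (by fun_prop)
  -- `l` is the optimal lower bound of `K`. It lies below `c ≤ 0`, hence is nonzero, and by `heig`
  -- it is not an eigenvalue. So `K - l` is bounded below in norm by the Fredholm alternative.
  set l := sSup S with hl
  have hlS : l ∈ S := hclosed.csSup_mem hne hbdd
  have hlc : l < c := hlt l hlS
  have hnot : ¬ Module.End.HasEigenvalue (K : Module.End ℝ H) l := by
    intro h
    obtain ⟨e, he⟩ := h.exists_hasEigenvector
    exact hlc.not_ge (heig l e he.2 (by simpa using he.apply_eq_smul))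
  obtain ⟨k, hk⟩ := IsCompactOperator.antilipschitz_of_not_hasEigenvalue hcomp (by linarith) hnot
  obtain ⟨k, hk0, hk⟩ := antilipschitzWith_iff_exists_mul_le_norm.1 ⟨k, hk⟩
  set X : H →L[ℝ] H := K - l • 1 with hX
  have hXi : ∀ v, ⟪X v, v⟫_ℝ = ⟪K v, v⟫_ℝ - l * ‖v‖ ^ 2 := fun v => by
    simp [hX, inner_sub_left, inner_smul_left]
  set b : ℝ := ‖K‖ - l + 1 with hb
  have hb0 : 0 < b := by have := norm_nonneg K; linarith
  have hle : ∀ v, ‖X v‖ ^ 2 ≤ b * ⟪X v, v⟫_ℝ := by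
    refine norm_apply_sq_le_of_bounds (fun v w => ?_) hb0 (fun v => ?_) (fun v => ?_)
    · simp [hX, inner_sub_left, inner_sub_right, inner_smul_left, inner_smul_right, hK]
    · rw [hXi]; linarith [hlS v]
    · rw [hXi, hb]; nlinarith [le_of_abs_le (habs v), sq_nonneg ‖v‖]
  -- For the nonnegative operator `X = K - l ≤ b`, the norm bound `k ‖v‖ ≤ ‖X v‖` becomes a form
  -- bound through `X² ≤ b X`, which contradicts the optimality of `l`.
  have hmem : l + k ^ 2 / b ∈ S := fun v => by
    have h1 : (k * ‖v‖) ^ 2 ≤ b * ⟪X v, v⟫_ℝ :=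
      (pow_le_pow_left₀ (by positivity) (hk v) 2).trans (hle v)
    have h2 : k ^ 2 / b * ‖v‖ ^ 2 ≤ ⟪X v, v⟫_ℝ := by
      rw [div_mul_eq_mul_div, div_le_iff₀ hb0]; linarith [mul_pow k ‖v‖ 2]
    rw [hXi] at h2
    linarith
  have h3 := le_csSup hbdd hmem
  have h4 : 0 < k ^ 2 / b := by positivity
  linarith

end Symmetric

/-! ### More on Hilbert-Schmidt operators -/

section HilbertSchmidt

variable {X Y Z : Type*}
  [NormedAddCommGroup X] [InnerProductSpace ℝ X] [CompleteSpace X]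
  [NormedAddCommGroup Y] [InnerProductSpace ℝ Y] [CompleteSpace Y]
  [NormedAddCommGroup Z] [InnerProductSpace ℝ Z] [CompleteSpace Z]

namespace HS

/-- The inclusion of the Hilbert-Schmidt operators into the bounded operators is continuous. -/
noncomputable def opL : HS X Y →L[ℝ] (X →L[ℝ] Y) :=
  LinearMap.mkContinuous op 1 fun T => by rw [one_mul]; exact T.norm_op_le

@[simp] theorem opL_apply (T : HS X Y) : opL T = T.op := rfl

theorem continuous_op : Continuous fun T : HS X Y => T.op := opL.continuous

theorem norm_compL_le (L : Y →L[ℝ] Z) (T : HS X Y) : ‖compL L T‖ ≤ ‖L‖ * ‖T‖ :=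
  LinearMap.mkContinuous_norm_le _ (norm_nonneg L) _ |> (compL L).le_of_opNorm_le <| T

theorem norm_compL_le_of_bound (L : Y →L[ℝ] Z) {C : ℝ} (hC : 0 ≤ C)
    (hL : ∀ y, ‖L y‖ ≤ C * ‖y‖) (T : HS X Y) : ‖compL L T‖ ≤ C * ‖T‖ :=
  (norm_compL_le L T).trans
    (mul_le_mul_of_nonneg_right (L.opNorm_le_bound hC hL) (norm_nonneg T))

theorem norm_compL_isometry (L : Y ≃ₗᵢ[ℝ] Z) (T : HS X Y) :
    ‖compL (L.toContinuousLinearEquiv : Y →L[ℝ] Z) T‖ = ‖T‖ := by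
  rw [← sq_eq_sq₀ (norm_nonneg _) (norm_nonneg _), norm_sq_def, norm_sq_def]
  simp

/-- A lower bound for a quadratic form is inherited by its lift to Hilbert-Schmidt operators. -/
theorem le_inner_compL (L : Y →L[ℝ] Y) {c : ℝ} (hL : ∀ y, c * ‖y‖ ^ 2 ≤ ⟪L y, y⟫_ℝ)
    (T : HS X Y) : c * ‖T‖ ^ 2 ≤ ⟪compL L T, T⟫_ℝ :=
  hasSum_le (fun _ => hL _) ((hasSum_sq (stdBasis X) T).mul_left c)
    (hasSum_inner (stdBasis X) (compL L T) T)

theorem isHilbertSchmidt_adjoint (T : HS X Y) :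
    IsHilbertSchmidt (ContinuousLinearMap.adjoint T.op) := by
  unfold IsHilbertSchmidt
  rw [summable_sq_iff (fun i => ContinuousLinearMap.adjoint T.op (stdBasis Y i)),
    ← tsum_sq_adjoint (stdBasis X) (stdBasis Y), ← summable_sq_iff (fun i => T.op (stdBasis X i))]
  exact T.isHilbertSchmidt

/-- The adjoint of a Hilbert-Schmidt operator. -/
noncomputable def adj (T : HS X Y) : HS Y X :=
  mk (ContinuousLinearMap.adjoint T.op) (isHilbertSchmidt_adjoint T)

@[simp] theorem op_adj (T : HS X Y) : (adj T).op = ContinuousLinearMap.adjoint T.op := rfl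

theorem norm_adj (T : HS X Y) : ‖adj T‖ = ‖T‖ := by
  rw [← sq_eq_sq₀ (norm_nonneg _) (norm_nonneg _)]
  have h1 := (hasSum_sq (stdBasis X) T)
  have h2 := (hasSum_sq (stdBasis Y) (adj T))
  have h3 := tsum_sq_adjoint (stdBasis X) (stdBasis Y) T.op
  rw [← ENNReal.ofReal_tsum_of_nonneg (fun i => sq_nonneg _) h1.summable, h1.tsum_eq,
    ← op_adj, ← ENNReal.ofReal_tsum_of_nonneg (fun i => sq_nonneg _) h2.summable, h2.tsum_eq,
    ENNReal.ofReal_eq_ofReal_iff (sq_nonneg _) (sq_nonneg _)] at h3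
  exact h3.symm

/-- Parseval's identity for `x` and the adjoint of `T` applied to `y`; `T` need only be bounded. -/
theorem hasSum_inner_rankOne (T : X →L[ℝ] Y) (x : X) (y : Y) :
    HasSum (fun i => ⟪T (stdBasis X i), InnerProductSpace.rankOne ℝ y x (stdBasis X i)⟫_ℝ)
      ⟪T x, y⟫_ℝ := by
  have h := (stdBasis X).hasSum_inner_mul_inner x (ContinuousLinearMap.adjoint T y)
  rw [ContinuousLinearMap.adjoint_inner_right] at h
  refine h.congr_fun ?_ |> fun h => h
  intro i
  simp [inner_smul_right, ContinuousLinearMap.adjoint_inner_right]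

theorem isHilbertSchmidt_rankOne (y : Y) (x : X) :
    IsHilbertSchmidt (InnerProductSpace.rankOne ℝ y x) := by
  have h := (hasSum_inner_rankOne (InnerProductSpace.rankOne ℝ y x) x y).summable
  simp only [real_inner_self_eq_norm_sq] at h
  exact h

/-- The operator `h ↦ ⟨x, h⟩ y` as a Hilbert-Schmidt operator. -/
noncomputable def rankOne (y : Y) (x : X) : HS X Y :=
  mk (InnerProductSpace.rankOne ℝ y x) (isHilbertSchmidt_rankOne y x)

@[simp] theorem op_rankOne_apply (y : Y) (x h : X) : (rankOne y x).op h = ⟪x, h⟫_ℝ • y := by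
  simp [rankOne]

/-- Rank-one test operators recover matrix coefficients, which turns a variational identity into a
pointwise one. -/
theorem inner_rankOne (T : HS X Y) (y : Y) (x : X) : ⟪T, rankOne y x⟫_ℝ = ⟪T.op x, y⟫_ℝ :=
  (hasSum_inner_rankOne T.op x y).tsum_eq

/-- Composition with a bounded operator on the right. -/
noncomputable def compR (T : HS Y Z) (L : X →L[ℝ] Y) : HS X Z :=
  adj (compL (ContinuousLinearMap.adjoint L) (adj T))

@[simp] theorem op_compR (T : HS Y Z) (L : X →L[ℝ] Y) : (compR T L).op = T.op ∘L L := by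
  simp [compR, ContinuousLinearMap.adjoint_comp]

theorem norm_compR_le (T : HS Y Z) (L : X →L[ℝ] Y) : ‖compR T L‖ ≤ ‖L‖ * ‖T‖ := by
  rw [compR, norm_adj, ← norm_adj T, ← ContinuousLinearMap.adjoint.norm_map L]
  exact norm_compL_le _ _

end HS

end HilbertSchmidt

/-! ### The operator Lyapunov equation -/

section Lyapunov

variable {V H : Type*}
  [NormedAddCommGroup V] [InnerProductSpace ℝ V] [CompleteSpace V]
  [NormedAddCommGroup H] [InnerProductSpace ℝ H] [CompleteSpace H]

variable (V) in
/-- The Riesz isomorphism of a real Hilbert space as a linear isometry. -/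
noncomputable def riesz : V ≃ₗᵢ[ℝ] StrongDual ℝ V where
  toLinearEquiv :=
    { (InnerProductSpace.toDual ℝ V).toEquiv with
      map_add' := map_add (InnerProductSpace.toDual ℝ V)
      map_smul' := fun c v => by ext w; simp }
  norm_map' := (InnerProductSpace.toDual ℝ V).norm_map

/-- By this evaluation formula, the adjoint of `riesz ∘ R : H → V*` extends a symmetric `R` from `H`
to `V*`. -/
theorem inner_riesz_right (f : StrongDual ℝ V) (w : V) : ⟪f, riesz V w⟫_ℝ = f w := by
  change ⟪(InnerProductSpace.toDual ℝ V).symm f,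
    (InnerProductSpace.toDual ℝ V).symm (InnerProductSpace.toDual ℝ V w)⟫_ℝ = f w
  rw [LinearIsometryEquiv.symm_apply_apply, InnerProductSpace.toDual_symm_apply]

theorem inner_riesz_symm (f : StrongDual ℝ V) (w : V) : ⟪(riesz V).symm f, w⟫_ℝ = f w :=
  InnerProductSpace.toDual_symm_apply

theorem mem_lowerBounded_iff {P : HS H H} {c : ℝ} : P ∈ lowerBounded H c ↔
    (∀ u v, ⟪P.op u, v⟫_ℝ = ⟪u, P.op v⟫_ℝ) ∧ ∀ u : H, c * ‖u‖ ^ 2 ≤ ⟪P.op u, u⟫_ℝ := by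
  unfold lowerBounded
  rw [mem_ofPred_eq, ContinuousLinearMap.isSelfAdjoint_iff_isSymmetric]
  rfl

/-- The operators `R ∈ HS(H, V)` that are symmetric as operators in `H`. -/
def symV (ι : V →L[ℝ] H) : Submodule ℝ (HS H V) where
  carrier := {R | ∀ x y, ⟪ι (R.op x), y⟫_ℝ = ⟪x, ι (R.op y)⟫_ℝ}
  zero_mem' := by simp
  add_mem' := fun {R S} hR hS x y => by
    simp only [map_add, add_apply, inner_add_left, inner_add_right, hR x y, hS x y]
  smul_mem' := fun c R hR x y => by
    simp only [map_smul, smul_apply, inner_smul_left, inner_smul_right, hR x y, conj_trivial]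

/-- Closedness supplies the completeness that Lax–Milgram needs. -/
theorem isClosed_symV (ι : V →L[ℝ] H) : IsClosed (symV ι : Set (HS H V)) := by
  have e : (symV ι : Set (HS H V))
      = ⋂ (x : H) (y : H), {R : HS H V | ⟪ι (R.op x), y⟫_ℝ = ⟪x, ι (R.op y)⟫_ℝ} := by
    ext R
    simp only [mem_iInter]
    rfl
  rw [e]
  have hc := HS.continuous_op (X := H) (Y := V)
  exact isClosed_iInter fun x => isClosed_iInter fun y => isClosed_eq (by fun_prop) (by fun_prop)

instance (ι : V →L[ℝ] H) : CompleteSpace (symV ι) := (isClosed_symV ι).completeSpace_coe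

variable {ι : V →L[ℝ] H}

theorem symV_symm (R : symV ι) (x y : H) : ⟪ι (R.1.op x), y⟫_ℝ = ⟪x, ι (R.1.op y)⟫_ℝ := R.2 x y

/-- A symmetric operator in `HS(H, V)` as an element of `𝒱`: it extends to `V*` by duality. -/
noncomputable def toOpV (R : symV ι) : opV ι :=
  ⟨WithLp.toLp 2 (HS.adj (HS.compL
      ((riesz V).toContinuousLinearEquiv : V →L[ℝ] StrongDual ℝ V) R.1), R.1),
    by
      refine ContinuousLinearMap.ext fun h => ext_inner_right ℝ fun k => ?_
      change ⟪ContinuousLinearMap.adjoint (HS.compL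
        ((riesz V).toContinuousLinearEquiv : V →L[ℝ] StrongDual ℝ V) R.1).op (pivot ι h), k⟫_ℝ
          = ⟪ι (R.1.op h), k⟫_ℝ
      -- Symmetry in `H` is what makes the two halves agree: both sides become `⟨h, ι R k⟩`.
      rw [symV_symm R, ContinuousLinearMap.adjoint_inner_left]
      exact inner_riesz_right (pivot ι h) (R.1.op k)⟩

theorem rightOp_toOpV (R : symV ι) : rightOp (toOpV R) = R.1.op := rfl

theorem inclHS_toOpV (R : symV ι) : inclHS ι (toOpV R) = HS.compL ι R.1 := rfl

theorem inner_leftOp_toOpV (R : symV ι) (f : StrongDual ℝ V) (h : H) :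
    ⟪leftOp (toOpV R) f, h⟫_ℝ = f (R.1.op h) := by
  have e : leftOp (toOpV R) = ContinuousLinearMap.adjoint (HS.compL
      ((riesz V).toContinuousLinearEquiv : V →L[ℝ] StrongDual ℝ V)
        R.1).op := rfl
  rw [e, ContinuousLinearMap.adjoint_inner_left]
  exact inner_riesz_right f (R.1.op h)

/-- The Riesz isometry and the adjoint preserve the Hilbert–Schmidt norm, so both halves contribute
equally. The factor 2 later turns `2μ ‖R‖²` into `μ ‖P‖²`. -/
theorem norm_sq_toOpV (R : symV ι) : ‖toOpV R‖ ^ 2 = 2 * ‖R.1‖ ^ 2 := by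
  have e1 : ‖(toOpV R).1.fst‖ = ‖R.1‖ :=
    (HS.norm_adj _).trans (HS.norm_compL_isometry (riesz V) R.1)
  have e2 : (toOpV R).1.snd = R.1 := rfl
  rw [norm_sq_opV, e1, e2]
  ring

/-- The operator `V → V` that represents the dual of `A : V → V*`. -/
noncomputable def dualRep (A : V →L[ℝ] StrongDual ℝ V) : V →L[ℝ] V :=
  ((riesz V).symm.toContinuousLinearEquiv : StrongDual ℝ V →L[ℝ] V) ∘L A.flip

theorem inner_dualRep (A : V →L[ℝ] StrongDual ℝ V) (u v : V) : ⟪dualRep A u, v⟫_ℝ = A v u := 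
  inner_riesz_symm (A.flip u) v

/-- The variational form of the equation `σ P + A* P + P A = Z`, in terms of `R : H → V` with
`P = ι R`. -/
def IsLyapunovSolution (σ : ℝ) (A : V →L[ℝ] StrongDual ℝ V) (Z : HS H H) (R : symV ι) : Prop :=
  ∀ S : symV ι, σ * ⟪HS.compL ι R.1, HS.compL ι S.1⟫_ℝ + 2 * ⟪HS.compL (dualRep A) R.1, S.1⟫_ℝ
    = ⟪Z, HS.compL ι S.1⟫_ℝ

/-- Moves the inner product of `HS(H, H)` to `HS(H, V)`, so that the whole bilinear form is given by
one operator on `V`. -/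
theorem inner_compL_adjoint_comp (L : V →L[ℝ] H) (R S : HS H V) :
    ⟪HS.compL (ContinuousLinearMap.adjoint L ∘L L) R, S⟫_ℝ = ⟪HS.compL L R, HS.compL L S⟫_ℝ := by
  rw [HS.inner_def, HS.inner_def]
  simp [ContinuousLinearMap.adjoint_inner_left]

theorem compL_add (L M : V →L[ℝ] V) (R : HS H V) :
    HS.compL (L + M) R = HS.compL L R + HS.compL M R :=
  HS.op_injective (by simp [ContinuousLinearMap.add_comp])

theorem compL_smul (c : ℝ) (L : V →L[ℝ] V) (R : HS H V) :
    HS.compL (c • L) R = c • HS.compL L R :=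
  HS.op_injective (by simp [ContinuousLinearMap.smul_comp])

theorem le_inner_compL_dualRep {A : V →L[ℝ] StrongDual ℝ V} {μ : ℝ}
    (hA : ∀ u, μ * ‖u‖ ^ 2 ≤ A u u) (R : HS H V) :
    μ * ‖R‖ ^ 2 ≤ ⟪HS.compL (dualRep A) R, R⟫_ℝ :=
  HS.le_inner_compL _ (fun u => by rw [inner_dualRep]; exact hA u) R

/-- Lax–Milgram on `symV ι`. For symmetric operators `A* P` and `P A` pair equally with the test
operator, whence the coercivity constant `2μ`; the term with `σ ≥ 0` only helps. -/
theorem exists_isLyapunovSolution {A : V →L[ℝ] StrongDual ℝ V} {μ σ : ℝ} (hμ : 0 < μ)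
    (hσ : 0 ≤ σ) (hA : ∀ u, μ * ‖u‖ ^ 2 ≤ A u u) (Z : HS H H) :
    ∃ R : symV ι, IsLyapunovSolution σ A Z R := by
  set M : V →L[ℝ] V := σ • (ContinuousLinearMap.adjoint ι ∘L ι) + (2 : ℝ) • dualRep A with hM
  set B : symV ι →L[ℝ] symV ι →L[ℝ] ℝ :=
    (symV ι).subtypeL.precomp ℝ ∘L innerSL ℝ ∘L HS.compL M ∘L (symV ι).subtypeL with hB
  have hBapp : ∀ R S, B R S = σ * ⟪HS.compL ι R.1, HS.compL ι S.1⟫_ℝ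
      + 2 * ⟪HS.compL (dualRep A) R.1, S.1⟫_ℝ := fun R S => by
    change ⟪HS.compL M R.1, S.1⟫_ℝ = _
    rw [hM, compL_add, compL_smul, compL_smul, inner_add_left, inner_smul_left, inner_smul_left,
      inner_compL_adjoint_comp]
    rfl
  have hco : IsCoercive B := by
    refine ⟨2 * μ, by positivity, fun R => ?_⟩
    rw [hBapp, real_inner_self_eq_norm_sq]
    have h1 := le_inner_compL_dualRep hA R.1
    have h2 : 0 ≤ σ * ‖HS.compL ι R.1‖ ^ 2 := by positivity
    have h3 : ‖R‖ = ‖R.1‖ := rfl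
    rw [h3]
    nlinarith
  set f : StrongDual ℝ (symV ι) := innerSL ℝ Z ∘L HS.compL ι ∘L (symV ι).subtypeL with hf
  refine ⟨hco.continuousLinearEquivOfBilin.symm ((InnerProductSpace.toDual ℝ _).symm f),
    fun S => ?_⟩
  rw [← hBapp, ← hco.continuousLinearEquivOfBilin_apply, ContinuousLinearEquiv.apply_symm_apply,
    InnerProductSpace.toDual_symm_apply]
  rfl

/-! ### Pointwise form of the Lyapunov equation, norm bounds and spectral bounds. -/

namespace IsLyapunovSolution

variable {σ : ℝ} {A : V →L[ℝ] StrongDual ℝ V} {Z : HS H H} {R : symV ι}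

theorem sub {Z' : HS H H} {R' : symV ι} (h : IsLyapunovSolution σ A Z R)
    (h' : IsLyapunovSolution σ A Z' R') : IsLyapunovSolution σ A (Z - Z') (R - R') := fun S => by
  rw [inner_sub_left, ← h S, ← h' S, Submodule.coe_sub, map_sub, map_sub, inner_sub_left,
    inner_sub_left]
  ring

/-- A solution of the variational equation solves the operator equation. -/
theorem pointwise (h : IsLyapunovSolution σ A Z R)
    (hZ : ∀ u v, ⟪Z.op u, v⟫_ℝ = ⟪u, Z.op v⟫_ℝ) (u v : V) :
    σ * ⟪ι (R.1.op (ι u)), ι v⟫_ℝ + (A v (R.1.op (ι u)) + A u (R.1.op (ι v)))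
      = ⟪Z.op (ι u), ι v⟫_ℝ := by
  -- Only symmetric test operators are admissible, so the rank-one operator is symmetrised. The
  -- symmetry of `R` and `Z` then merges the doubled terms.
  have hS : HS.rankOne v (ι u) + HS.rankOne u (ι v) ∈ symV ι := fun x y => by
    simp only [map_add, add_apply, HS.op_rankOne_apply, map_smul, inner_add_left, inner_add_right,
      inner_smul_left, inner_smul_right, conj_trivial, real_inner_comm]
    ring
  have e : ∀ (w : V) (x : H), HS.compL ι (HS.rankOne w x) = HS.rankOne (ι w) x := fun w x =>
    HS.op_injective (ContinuousLinearMap.ext fun y => by simp)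
  have h1 := h ⟨_, hS⟩
  simp only [map_add, e, inner_add_right, HS.inner_rankOne, HS.op_compL,
    ContinuousLinearMap.comp_apply, inner_dualRep] at h1
  have h2 : ⟪ι (R.1.op (ι v)), ι u⟫_ℝ = ⟪ι (R.1.op (ι u)), ι v⟫_ℝ := by
    rw [symV_symm, real_inner_comm]
  have h3 : ⟪Z.op (ι v), ι u⟫_ℝ = ⟪Z.op (ι u), ι v⟫_ℝ := by
    rw [hZ, real_inner_comm]
  rw [h2, h3] at h1
  linarith

/-- Test with `R` itself, use `μ ‖R‖² ≥ (μ/C²) ‖ι R‖²` twice, and divide by `‖ι R‖`. This is the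
gain in the contraction estimate. -/
theorem norm_compL_le {μ C : ℝ} (h : IsLyapunovSolution σ A Z R) (hμ : 0 < μ)
    (hA : ∀ u, μ * ‖u‖ ^ 2 ≤ A u u) (hC : 0 < C) (hι : ∀ v, ‖ι v‖ ≤ C * ‖v‖) :
    (σ + 2 * (μ / C ^ 2)) * ‖HS.compL ι R.1‖ ≤ ‖Z‖ := by
  rcases (norm_nonneg (HS.compL ι R.1)).eq_or_lt with h0 | h0
  · rw [← h0, mul_zero]; exact norm_nonneg Z
  have h1 := h R
  rw [real_inner_self_eq_norm_sq] at h1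
  have h2 := le_inner_compL_dualRep hA R.1
  have h3 := HS.norm_compL_le_of_bound ι hC.le hι R.1
  have h4 : ‖HS.compL ι R.1‖ ^ 2 ≤ C ^ 2 * ‖R.1‖ ^ 2 := by
    rw [← mul_pow]; exact pow_le_pow_left₀ (norm_nonneg _) h3 2
  have h5 : μ / C ^ 2 * ‖HS.compL ι R.1‖ ^ 2 ≤ μ * ‖R.1‖ ^ 2 := by
    rw [div_mul_eq_mul_div, div_le_iff₀ (by positivity)]
    nlinarith
  have h6 := real_inner_le_norm Z (HS.compL ι R.1)
  refine le_of_mul_le_mul_right ?_ h0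
  nlinarith

/-- Eigenvectors of a solution turn the equation into a scalar one. -/
theorem eigenvector {μ C : ℝ} (h : IsLyapunovSolution σ A Z R)
    (hZ : ∀ u v, ⟪Z.op u, v⟫_ℝ = ⟪u, Z.op v⟫_ℝ) (hμ : 0 < μ)
    (hA : ∀ u, μ * ‖u‖ ^ 2 ≤ A u u) (hC : 0 < C) (hι : ∀ v, ‖ι v‖ ≤ C * ‖v‖)
    {l : ℝ} (hl : l ≠ 0) {e : H} (he : ι (R.1.op e) = l • e) :
    ∃ α : ℝ, μ / C ^ 2 * ‖e‖ ^ 2 ≤ α ∧ l * (σ * ‖e‖ ^ 2 + 2 * α) = ⟪Z.op e, e⟫_ℝ := by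
  -- Since `l ≠ 0`, the eigenvector is the image of this `v ∈ V`; the number `α` will be `A v v`.
  set v : V := l⁻¹ • R.1.op e with hv
  have hιv : ι v = e := by rw [hv, map_smul, he, inv_smul_smul₀ hl]
  have hRe : R.1.op e = l • v := by rw [hv, smul_inv_smul₀ hl]
  refine ⟨A v v, ?_, ?_⟩
  · refine le_trans ?_ (hA v)
    have h4 : ‖e‖ ^ 2 ≤ C ^ 2 * ‖v‖ ^ 2 := by
      rw [← mul_pow, ← hιv]; exact pow_le_pow_left₀ (norm_nonneg _) (hι v) 2
    rw [div_mul_eq_mul_div, div_le_iff₀ (by positivity)]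
    nlinarith
  · have h1 := h.pointwise hZ v v
    rw [hιv, he, hRe, map_smul, inner_smul_left, real_inner_self_eq_norm_sq, smul_eq_mul,
      conj_trivial] at h1
    linarith

/-- A lower bound of the right-hand side yields a lower bound of the solution. -/
theorem lower_bound {μ C g : ℝ} (h : IsLyapunovSolution σ A Z R)
    (hcomp : IsCompactOperator ι)
    (hZ : ∀ u v, ⟪Z.op u, v⟫_ℝ = ⟪u, Z.op v⟫_ℝ) (hμ : 0 < μ) (hσ : 0 ≤ σ)
    (hA : ∀ u, μ * ‖u‖ ^ 2 ≤ A u u) (hC : 0 < C) (hι : ∀ v, ‖ι v‖ ≤ C * ‖v‖) (hg : 0 ≤ g)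
    (hZg : ∀ u, -(g * (σ + 2 * (μ / C ^ 2))) * ‖u‖ ^ 2 ≤ ⟪Z.op u, u⟫_ℝ) (u : H) :
    -g * ‖u‖ ^ 2 ≤ ⟪ι (R.1.op u), u⟫_ℝ := by
  refine lower_bound_of_eigenvalues (K := ι ∘L R.1.op) (symV_symm R) (hcomp.comp_clm R.1.op)
    (by linarith) (fun l e he0 he => ?_) u
  -- An eigenvalue `l < -g` is negative, so enlarging `α` only lowers the left side of the scalar
  -- equation. The form of `Z` at `e` then falls below the bound `hZg`.
  by_contra! hl
  obtain ⟨α, hα, hl2⟩ := h.eigenvector hZ hμ hA hC hι (l := l) (by linarith : l < 0).ne he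
  have h1 := hZg e
  rw [← hl2] at h1
  have hen : 0 < ‖e‖ ^ 2 := by positivity
  have hmu : 0 < μ / C ^ 2 := by positivity
  have hs : 0 ≤ σ * ‖e‖ ^ 2 := by positivity
  have hs2 : 0 < μ / C ^ 2 * ‖e‖ ^ 2 := by positivity
  have h2 : l * (σ * ‖e‖ ^ 2 + 2 * α) ≤ l * (σ * ‖e‖ ^ 2 + 2 * (μ / C ^ 2 * ‖e‖ ^ 2)) :=
    mul_le_mul_of_nonpos_left (by linarith) (by linarith)
  have h3 : l * (σ * ‖e‖ ^ 2 + 2 * (μ / C ^ 2 * ‖e‖ ^ 2))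
      < -g * (σ * ‖e‖ ^ 2 + 2 * (μ / C ^ 2 * ‖e‖ ^ 2)) :=
    mul_lt_mul_of_pos_right hl (by linarith)
  linarith

/-- An upper bound of the right-hand side yields an upper bound of the solution. -/
theorem upper_bound {μ C g : ℝ} (h : IsLyapunovSolution σ A Z R)
    (hcomp : IsCompactOperator ι)
    (hZ : ∀ u v, ⟪Z.op u, v⟫_ℝ = ⟪u, Z.op v⟫_ℝ) (hμ : 0 < μ) (hσ : 0 ≤ σ)
    (hA : ∀ u, μ * ‖u‖ ^ 2 ≤ A u u) (hC : 0 < C) (hι : ∀ v, ‖ι v‖ ≤ C * ‖v‖) (hg : 0 ≤ g)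
    (hZg : ∀ u, ⟪Z.op u, u⟫_ℝ ≤ g * (σ + 2 * (μ / C ^ 2)) * ‖u‖ ^ 2) (u : H) :
    ⟪ι (R.1.op u), u⟫_ℝ ≤ g * ‖u‖ ^ 2 := by
  have hneg : IsLyapunovSolution σ A (-Z) (-R) := fun S => by
    rw [inner_neg_left, ← h S, Submodule.coe_neg, map_neg, map_neg, inner_neg_left,
      inner_neg_left]
    ring
  have := hneg.lower_bound hcomp (fun u v => by simp [hZ]) hμ hσ hA hC hι hg
    (fun u => by simpa using hZg u) u
  simpa using this

end IsLyapunovSolution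

end Lyapunov

/-! ### One step of the backward Euler scheme -/

section Step

variable {V H : Type*}
  [NormedAddCommGroup V] [InnerProductSpace ℝ V] [CompleteSpace V]
  [NormedAddCommGroup H] [InnerProductSpace ℝ H] [CompleteSpace H]

/-- The symmetric Hilbert-Schmidt operators `K` with `-γ ≤ K ≤ b`. -/
def symBounded (H : Type*) [NormedAddCommGroup H] [InnerProductSpace ℝ H] [CompleteSpace H]
    (γ b : ℝ) : Set (HS H H) :=
  {K | (∀ u v, ⟪K.op u, v⟫_ℝ = ⟪u, K.op v⟫_ℝ) ∧ (∀ u, -γ * ‖u‖ ^ 2 ≤ ⟪K.op u, u⟫_ℝ) ∧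
    ∀ u, ⟪K.op u, u⟫_ℝ ≤ b * ‖u‖ ^ 2}

theorem isClosed_symBounded (γ b : ℝ) : IsClosed (symBounded H γ b) := by
  have e : symBounded H γ b
      = (⋂ (u : H) (v : H), {K : HS H H | ⟪K.op u, v⟫_ℝ = ⟪u, K.op v⟫_ℝ}) ∩
        ((⋂ u : H, {K : HS H H | -γ * ‖u‖ ^ 2 ≤ ⟪K.op u, u⟫_ℝ}) ∩
          ⋂ u : H, {K : HS H H | ⟪K.op u, u⟫_ℝ ≤ b * ‖u‖ ^ 2}) := by
    ext K
    simp [symBounded]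
  rw [e]
  have hc := HS.continuous_op (X := H) (Y := H)
  exact (isClosed_iInter fun u => isClosed_iInter fun v =>
    isClosed_eq (by fun_prop) (by fun_prop)).inter
    ((isClosed_iInter fun u => isClosed_le (by fun_prop) (by fun_prop)).inter
      (isClosed_iInter fun u => isClosed_le (by fun_prop) (by fun_prop)))

/-- The map `K ↦ 2 β K - K²`. -/
noncomputable def shiftSq (β : ℝ) (K : HS H H) : HS H H := (2 * β) • K - HS.compL K.op K

theorem shiftSq_op_inner (β : ℝ) {K : HS H H} (hK : ∀ u v, ⟪K.op u, v⟫_ℝ = ⟪u, K.op v⟫_ℝ)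
    (u : H) : ⟪(shiftSq β K).op u, u⟫_ℝ = 2 * β * ⟪K.op u, u⟫_ℝ - ‖K.op u‖ ^ 2 := by
  simp [shiftSq, inner_sub_left, inner_smul_left, hK (K.op u) u]

theorem shiftSq_symm (β : ℝ) {K : HS H H} (hK : ∀ u v, ⟪K.op u, v⟫_ℝ = ⟪u, K.op v⟫_ℝ)
    (u v : H) : ⟪(shiftSq β K).op u, v⟫_ℝ = ⟪u, (shiftSq β K).op v⟫_ℝ := by
  simp [shiftSq, inner_sub_left, inner_sub_right, inner_smul_left, inner_smul_right, hK]

/-- On `[-γ, β]` the scalar function `2βt - t²` is smallest at `t = -γ`. For operators this follows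
from `X² ≤ (2β + 2γ) X` with `X = K + γ`. -/
theorem le_shiftSq {β γ : ℝ} (hβ : 0 < β) (hγ : 0 ≤ γ) {K : HS H H} (hK : K ∈ symBounded H γ β)
    (u : H) : -(2 * β * γ + γ ^ 2) * ‖u‖ ^ 2 ≤ ⟪(shiftSq β K).op u, u⟫_ℝ := by
  obtain ⟨hs, h1, h2⟩ := hK
  set X : H →L[ℝ] H := K.op + γ • 1 with hX
  have hXi : ∀ v, ⟪X v, v⟫_ℝ = ⟪K.op v, v⟫_ℝ + γ * ‖v‖ ^ 2 := fun v => by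
    simp [hX, inner_add_left, inner_smul_left]
  have h3 := norm_apply_sq_le_of_bounds (X := X) (c := 2 * β + 2 * γ)
    (fun v w => by simp [hX, inner_add_left, inner_add_right, inner_smul_left, inner_smul_right,
      hs]) (by linarith) (fun v => by rw [hXi]; linarith [h1 v])
    (fun v => by rw [hXi]; nlinarith [h2 v, sq_nonneg ‖v‖]) u
  have h4 : ‖X u‖ ^ 2 = ‖K.op u‖ ^ 2 + 2 * γ * ⟪K.op u, u⟫_ℝ + γ ^ 2 * ‖u‖ ^ 2 := by
    have : X u = K.op u + γ • u := by simp [hX]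
    rw [this, norm_add_sq_real, norm_smul, inner_smul_right, mul_pow, Real.norm_eq_abs, sq_abs]
    ring
  rw [h4, hXi] at h3
  rw [shiftSq_op_inner β hs]
  nlinarith [h3]

theorem shiftSq_le {β γ : ℝ} (hβ : 0 < β) {K : HS H H} (hK : K ∈ symBounded H γ β)
    (u : H) : ⟪(shiftSq β K).op u, u⟫_ℝ ≤ 2 * β * β * ‖u‖ ^ 2 := by
  rw [shiftSq_op_inner β hK.1]
  have := hK.2.2 u
  nlinarith [sq_nonneg ‖K.op u‖]

/-- With `G = 2β - K - K'` the difference is the symmetrised product `(G (K - K') + (K - K') G) /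
2`, valid without commutation. Since `0 ≤ G ≤ 2β + 2γ`, the constant is `2β + 2γ`, not the larger
bound from estimating the terms separately. -/
theorem norm_shiftSq_sub_le {β γ : ℝ} (hβ : 0 < β) (hγ : 0 ≤ γ) {K K' : HS H H}
    (hK : K ∈ symBounded H γ β) (hK' : K' ∈ symBounded H γ β) :
    ‖shiftSq β K - shiftSq β K'‖ ≤ (2 * β + 2 * γ) * ‖K - K'‖ := by
  set G : H →L[ℝ] H := (2 * β) • 1 - (K.op + K'.op) with hG
  have hGi : ∀ v, ⟪G v, v⟫_ℝ = 2 * β * ‖v‖ ^ 2 - (⟪K.op v, v⟫_ℝ + ⟪K'.op v, v⟫_ℝ) := fun v => by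
    simp [hG, inner_add_left, inner_sub_left, inner_smul_left]
  have hGn : ‖G‖ ≤ 2 * β + 2 * γ := by
    refine norm_le_of_bounds (fun v w => ?_) (by linarith) (fun v => ?_) (fun v => ?_)
    · simp [hG, inner_add_left, inner_add_right, inner_sub_left, inner_sub_right,
        inner_smul_left, inner_smul_right, hK.1, hK'.1]
    · rw [hGi]; linarith [hK.2.2 v, hK'.2.2 v]
    · rw [hGi]; linarith [hK.2.1 v, hK'.2.1 v]
  have e : shiftSq β K - shiftSq β K'
      = (2⁻¹ : ℝ) • (HS.compL G (K - K') + HS.compR (K - K') G) := by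
    apply HS.op_injective
    ext u
    simp only [shiftSq, hG, map_sub, map_add, map_smul, HS.op_compL, HS.op_compR, sub_apply,
      add_apply, smul_apply, ContinuousLinearMap.comp_apply, one_apply_eq_self]
    module
  rw [e, norm_smul]
  have h1 := HS.norm_compL_le G (K - K')
  have h2 := HS.norm_compR_le (K - K') G
  have h3 := norm_add_le (HS.compL G (K - K')) (HS.compR (K - K') G)
  have h4 := mul_le_mul_of_nonneg_right hGn (norm_nonneg (K - K'))
  rw [Real.norm_of_nonneg (by norm_num)]
  linarith

variable {ι : V →L[ℝ] H}

/-- The Riccati equation `σ P + A* P + P A + P² = Z` has a solution `P = ι R ≥ -γ` if the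
right-hand side is bounded below by `-γ² - γ σ`. -/
theorem exists_riccati_solution (hcomp : IsCompactOperator ι) {C : ℝ} (hC : 0 < C)
    (hι : ∀ v, ‖ι v‖ ≤ C * ‖v‖) {A : V →L[ℝ] StrongDual ℝ V} {μ σ γ : ℝ} (hμ : 0 < μ)
    (hA : ∀ u, μ * ‖u‖ ^ 2 ≤ A u u) (hσ : 0 < σ) (hγ : 0 ≤ γ) (hγμ : γ < μ / C ^ 2)
    {Z : HS H H} (hZ : Z ∈ lowerBounded H (-(γ ^ 2 + γ * σ))) :
    ∃ R : symV ι, (∀ u, -γ * ‖u‖ ^ 2 ≤ ⟪ι (R.1.op u), u⟫_ℝ) ∧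
      IsLyapunovSolution σ A (Z - HS.compL (HS.compL ι R.1).op (HS.compL ι R.1)) R := by
  rw [mem_lowerBounded_iff] at hZ
  obtain ⟨hZs, hZl⟩ := hZ
  -- Large enough that `Z ≤ β σ`, so the upper bound `β` is reproduced; the summand 1 ensures `β >
  -- 0`.
  set β : ℝ := (‖Z‖ + 1) / σ with hβdef
  have hβ : 0 < β := by have := norm_nonneg Z; positivity
  have hβσ : ‖Z‖ ≤ β * σ := by rw [hβdef, div_mul_cancel₀ _ hσ.ne']; linarith
  have hm : 0 < μ / C ^ 2 := by positivity
  set σ' : ℝ := σ + 2 * β with hσ'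
  have hσ'0 : 0 ≤ σ' := by positivity
  choose F hF using fun K : HS H H =>
    exists_isLyapunovSolution (ι := ι) hμ hσ'0 hA (Z + shiftSq β K)
  have hsymm : ∀ K ∈ symBounded H γ β, ∀ u v,
      ⟪(Z + shiftSq β K).op u, v⟫_ℝ = ⟪u, (Z + shiftSq β K).op v⟫_ℝ := fun K hK u v => by
    simp only [map_add, add_apply, inner_add_left, inner_add_right, hZs,
      shiftSq_symm β hK.1]
  set f : HS H H → HS H H := fun K => HS.compL ι (F K).1 with hf
  have hmaps : MapsTo f (symBounded H γ β) (symBounded H γ β) := by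
    intro K hK
    refine ⟨fun u v => symV_symm (F K) u v, ?_, ?_⟩
    · refine (hF K).lower_bound hcomp (hsymm K hK) hμ hσ'0 hA hC hι hγ fun u => ?_
      have h1 := le_shiftSq hβ hγ hK u
      have h2 := hZl u
      -- The two lower bounds add up to `-γ σ' - 2γ²`; `γ ≤ μ/C²` bounds this below by `-γ (σ' +
      -- 2μ/C²)`, as `lower_bound` requires.
      have h3 : γ * γ ≤ γ * (μ / C ^ 2) := mul_le_mul_of_nonneg_left hγμ.le hγ
      simp only [map_add, add_apply, inner_add_left]
      nlinarith [sq_nonneg ‖u‖]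
    · refine (hF K).upper_bound hcomp (hsymm K hK) hμ hσ'0 hA hC hι hβ.le fun u => ?_
      have h1 := shiftSq_le hβ hK u
      have h2 : ⟪Z.op u, u⟫_ℝ ≤ ‖Z‖ * ‖u‖ ^ 2 := (real_inner_le_norm _ _).trans (by
        rw [sq, ← mul_assoc]; gcongr; exact Z.norm_op_apply_le u)
      have h3 := mul_le_mul_of_nonneg_right hβσ (sq_nonneg ‖u‖)
      have h4 : 0 ≤ β * (μ / C ^ 2) * ‖u‖ ^ 2 := by positivity
      simp only [map_add, add_apply, inner_add_left]
      nlinarith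
  set D : ℝ := σ' + 2 * (μ / C ^ 2) with hD
  have hD0 : 0 < D := by positivity
  have hcontr : ContractingWith (Real.toNNReal ((2 * β + 2 * γ) / D))
      (hmaps.restrict f (symBounded H γ β) (symBounded H γ β)) := by
    constructor
    · rw [← NNReal.coe_lt_coe, Real.coe_toNNReal _ (by positivity), NNReal.coe_one,
        div_lt_one hD0]
      -- The quotient is below 1 because `D = σ + 2β + 2μ/C²` with `σ > 0` and `γ < μ/C²`.
      linarith
    · refine LipschitzWith.of_dist_le_mul fun K K' => ?_
      rw [Real.coe_toNNReal _ (by positivity)]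
      have h1 := ((hF K.1).sub (hF K'.1)).norm_compL_le hμ hA hC hι
      rw [add_sub_add_left_eq_sub, Submodule.coe_sub, map_sub] at h1
      have h2 := norm_shiftSq_sub_le hβ hγ K.2 K'.2
      rw [Subtype.dist_eq, Subtype.dist_eq, dist_eq_norm, dist_eq_norm, div_mul_eq_mul_div,
        le_div_iff₀ hD0, mul_comm]
      exact h1.trans h2
  have h0 : (0 : HS H H) ∈ symBounded H γ β :=
    ⟨fun u v => by simp, fun u => by simp; positivity, fun u => by simp; positivity⟩
  obtain ⟨K, hK, hKf, -, -⟩ := hcontr.exists_fixedPoint' (isClosed_symBounded γ β).isComplete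
    hmaps h0 (edist_ne_top _ _)
  refine ⟨F K, (hmaps hK).2.1, fun S => ?_⟩
  -- At the fixed point the shift `2β K` cancels from both sides.
  have h1 := hF K S
  have h2 : HS.compL ι (F K).1 = K := hKf
  rw [h2] at h1 ⊢
  rw [shiftSq, inner_add_left, inner_sub_left, inner_smul_left, conj_trivial, hσ'] at h1
  rw [inner_sub_left]
  linarith

/-- The Riccati equation with `σ = 1/τ` and `Z = Q + P'/τ`, together with its energy inequality,
obtained by testing with the solution. -/
theorem exists_eulerStep (hcomp : IsCompactOperator ι) {C : ℝ} (hC : 0 < C)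
    (hι : ∀ v, ‖ι v‖ ≤ C * ‖v‖) {A : V →L[ℝ] StrongDual ℝ V} {μ τ γ : ℝ} (hμ : 0 < μ)
    (hA : ∀ u, μ * ‖u‖ ^ 2 ≤ A u u) (hτ : 0 < τ) (hγ : 0 ≤ γ) (hγμ : γ < μ / C ^ 2)
    {Q P' : HS H H} (hQ : Q ∈ lowerBounded H (-γ ^ 2)) (hP' : P' ∈ lowerBounded H (-γ)) :
    ∃ P : opV ι, IsEulerStep ι τ A Q P' P ∧ inclHS ι P ∈ lowerBounded H (-γ) ∧
      τ⁻¹ * ⟪inclHS ι P - P', inclHS ι P⟫_ℝ + (μ - γ * C ^ 2 / 2) * ‖P‖ ^ 2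
        ≤ ⟪Q, inclHS ι P⟫_ℝ := by
  rw [mem_lowerBounded_iff] at hQ hP'
  have hτi : 0 < τ⁻¹ := inv_pos.2 hτ
  have hZ : Q + τ⁻¹ • P' ∈ lowerBounded H (-(γ ^ 2 + γ * τ⁻¹)) := by
    rw [mem_lowerBounded_iff]
    refine ⟨fun u v => ?_, fun u => ?_⟩
    · simp only [map_add, map_smul, add_apply, smul_apply, inner_add_left, inner_add_right,
        inner_smul_left, inner_smul_right, hQ.1 u v, hP'.1 u v, conj_trivial]
    · simp only [map_add, map_smul, add_apply, smul_apply, inner_add_left, inner_smul_left,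
        conj_trivial]
      have h1 := hQ.2 u
      have h2 := mul_le_mul_of_nonneg_left (hP'.2 u) hτi.le
      linarith
  obtain ⟨R, hR, hsol⟩ := exists_riccati_solution hcomp hC hι hμ hA hτi hγ hγμ hZ
  set K : HS H H := HS.compL ι R.1 with hKdef
  have hKs : ∀ u v, ⟪K.op u, v⟫_ℝ = ⟪u, K.op v⟫_ℝ := symV_symm R
  have hKi : inclHS ι (toOpV R) = K := inclHS_toOpV R
  rw [mem_lowerBounded_iff] at hZ
  have hpt := hsol.pointwise (fun u v => by
    simp only [map_sub, sub_apply, inner_sub_left, inner_sub_right, hZ.1 u v, HS.op_compL K.op K,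
      ContinuousLinearMap.comp_apply, hKs])
  refine ⟨toOpV R, ?_, ?_, ?_⟩
  · ext u v
    have h1 := hpt u v
    have h2 : pivot ι (leftOp (toOpV R) (A u)) v = A u (R.1.op (ι v)) := by
      rw [pivot_apply, inner_leftOp_toOpV]
    have h3 : ι (R.1.op (ι u)) = K.op (ι u) := rfl
    rw [h3] at h1
    simp only [map_sub, map_add, map_smul, sub_apply, add_apply, smul_apply, inner_sub_left,
      inner_add_left, inner_smul_left, conj_trivial, HS.op_compL K.op K,
      ContinuousLinearMap.comp_apply] at h1
    simp only [asVtoDual, hKi, rightOp_toOpV, map_sub, add_apply, smul_apply, sub_apply,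
      ContinuousLinearMap.comp_apply, h2, pivot_apply, smul_eq_mul,
      ContinuousLinearMap.flip_apply]
    linarith
  · rw [hKi, mem_lowerBounded_iff]
    exact ⟨hKs, hR⟩
  · rw [hKi, norm_sq_toOpV]
    have h1 := hsol R
    have h2 := le_inner_compL_dualRep hA R.1
    -- The lower bound of `K` is applied to each `K e_i`. With `‖K‖² ≤ C² ‖R‖² = (C²/2) ‖P‖²` the
    -- loss is `γ C²/2`.
    have h3 : -γ * ‖K‖ ^ 2 ≤ ⟪HS.compL K.op K, K⟫_ℝ := HS.le_inner_compL K.op hR K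
    have h4 : ‖K‖ ^ 2 ≤ C ^ 2 * ‖R.1‖ ^ 2 := by
      rw [← mul_pow]
      exact pow_le_pow_left₀ (norm_nonneg _) (HS.norm_compL_le_of_bound ι hC.le hι R.1) 2
    have h5 := mul_le_mul_of_nonneg_left h4 hγ
    rw [← hKdef, inner_sub_left, inner_add_left, inner_smul_left, conj_trivial] at h1
    rw [inner_sub_left]
    linarith

end Step

/-! ### The averaged data and the backward Euler scheme -/

section Means

variable {V H : Type*}
  [NormedAddCommGroup V] [InnerProductSpace ℝ V] [CompleteSpace V]
  [NormedAddCommGroup H] [InnerProductSpace ℝ H] [CompleteSpace H]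
  {T : ℝ} {N : ℕ}

theorem stepSize_pos (hT : 0 < T) (n : Fin N) : 0 < stepSize T N :=
  div_pos hT (by exact_mod_cast n.pos)

theorem gridPoint_sub (T : ℝ) (N n : ℕ) :
    gridPoint T N (n + 1) - gridPoint T N n = stepSize T N := by
  unfold gridPoint; push_cast; ring

theorem intervalIntegrable_grid {E : Type*} [NormedAddCommGroup E] (hT : 0 < T) {f : ℝ → E}
    (hf : IntegrableOn f (Icc 0 T)) (n : Fin N) :
    IntervalIntegrable f volume (gridPoint T N n) (gridPoint T N (n + 1)) := by
  rw [intervalIntegrable_iff_integrableOn_Icc_of_le (gridPoint_le hT N n)]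
  exact hf.mono_set (grid_subset hT n)

theorem ae_grid (hT : 0 < T) {p : ℝ → Prop} (hp : ∀ᵐ t ∂(volume.restrict (Icc 0 T)), p t)
    (n : Fin N) : ∀ᵐ t ∂(volume.restrict (Icc (gridPoint T N n) (gridPoint T N (n + 1)))), p t :=
  ae_restrict_of_ae_restrict_of_subset (grid_subset hT n) hp

/-- A lower bound for the mean value of a function over a subinterval of the grid. -/
theorem le_mean_of_ae (hT : 0 < T) {f : ℝ → ℝ} (hf : IntegrableOn f (Icc 0 T)) {c : ℝ}
    (hc : ∀ᵐ t ∂(volume.restrict (Icc 0 T)), c ≤ f t) (n : Fin N) :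
    c ≤ (stepSize T N)⁻¹ * ∫ t in gridPoint T N n..gridPoint T N (n + 1), f t := by
  have hτ := stepSize_pos hT n
  have h := intervalIntegral.integral_mono_ae_restrict (gridPoint_le hT N n)
    (intervalIntegrable_const (c := c)) (intervalIntegrable_grid hT hf n) (ae_grid hT hc n)
  rw [intervalIntegral.integral_const, gridPoint_sub, smul_eq_mul] at h
  rw [le_inv_mul_iff₀ hτ]
  exact h

theorem meanOperator_coercive {μ η : ℝ} {a : ℝ → V →ₗ[ℝ] V →ₗ[ℝ] ℝ}
    (ha : IsUniformForm T μ η a) (hT : 0 < T) (n : Fin N) (u : V) :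
    μ * ‖u‖ ^ 2 ≤ meanOperator ha hT n u u := by
  rw [meanOperator_apply]
  refine le_mean_of_ae hT ?_ ?_ n
  · refine Integrable.of_bound (ha.measurable u u).aestronglyMeasurable (η * ‖u‖ * ‖u‖) ?_
    filter_upwards [ae_restrict_mem measurableSet_Icc] with t ht
    exact ha.bounded t ht u u
  · filter_upwards [ae_restrict_mem measurableSet_Icc] with t ht
    exact ha.coercive t ht u

theorem map_meanRhs (hT : 0 < T) {Q : ℝ → HS H H} (hQ : IntegrableOn Q (Icc 0 T)) (n : Fin N)
    (f : StrongDual ℝ (HS H H)) : f (meanRhs T N Q n)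
      = (stepSize T N)⁻¹ * ∫ t in gridPoint T N n..gridPoint T N (n + 1), f (Q t) := by
  rw [meanRhs, map_smul, smul_eq_mul,
    f.intervalIntegral_comp_comm (intervalIntegrable_grid hT hQ n)]

/-- The functional `K ↦ ⟨K u, v⟩`. -/
noncomputable def matrixCoeff (u v : H) : StrongDual ℝ (HS H H) :=
  innerSL ℝ v ∘L ContinuousLinearMap.apply ℝ H u ∘L HS.opL

theorem matrixCoeff_apply (u v : H) (K : HS H H) : matrixCoeff u v K = ⟪K.op u, v⟫_ℝ :=
  real_inner_comm _ _

/-- Matrix coefficients are bounded functionals and so commute with the Bochner integral, which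
reduces both conditions to real integrals. -/
theorem meanRhs_mem_lowerBounded (hT : 0 < T) {Q : ℝ → HS H H}
    (hQ : IntegrableOn Q (Icc 0 T)) {c : ℝ}
    (hQc : ∀ᵐ t ∂(volume.restrict (Icc 0 T)), Q t ∈ lowerBounded H c) (n : Fin N) :
    meanRhs T N Q n ∈ lowerBounded H c := by
  rw [mem_lowerBounded_iff]
  constructor
  · intro u v
    rw [real_inner_comm _ u, ← matrixCoeff_apply, ← matrixCoeff_apply, map_meanRhs hT hQ,
      map_meanRhs hT hQ]
    congr 1
    have hae : ∀ᵐ t ∂(volume.restrict (Icc (gridPoint T N n) (gridPoint T N (n + 1)))),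
        matrixCoeff u v (Q t) = matrixCoeff v u (Q t) := by
      filter_upwards [ae_grid hT hQc n] with t ht
      rw [matrixCoeff_apply, matrixCoeff_apply, (mem_lowerBounded_iff.1 ht).1, real_inner_comm]
    rw [intervalIntegral.integral_of_le (gridPoint_le hT N n),
      intervalIntegral.integral_of_le (gridPoint_le hT N n)]
    exact integral_congr_ae (ae_restrict_of_ae_restrict_of_subset Ioc_subset_Icc_self hae)
  · intro u
    rw [← matrixCoeff_apply, map_meanRhs hT hQ]
    refine le_mean_of_ae hT ((matrixCoeff u u).integrable_comp hQ) ?_ n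
    filter_upwards [hQc] with t ht
    rw [matrixCoeff_apply]
    exact (mem_lowerBounded_iff.1 ht).2 u

theorem integrableOn_norm_toDualV_sq {ι : V →L[ℝ] H} {Q : ℝ → HS H H}
    (hQ : MemLp Q 2 (volume.restrict (Icc 0 T))) :
    IntegrableOn (fun t => ‖toDualV ι (Q t)‖ ^ 2) (Icc 0 T) := by
  have hle : ∀ K : HS H H, ‖toDualV ι K‖ ≤ ‖inclHS ι‖ * ‖K‖ := fun K => by
    rw [mul_comm, ← innerSL_apply_norm ℝ K]
    exact ContinuousLinearMap.opNorm_comp_le _ _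
  have hc : Continuous fun K : HS H H => ‖toDualV ι K‖ := by
    refine (LipschitzWith.of_dist_le' (K := ‖inclHS ι‖) fun K K' => ?_).continuous
    have e : toDualV ι K - toDualV ι K' = toDualV ι (K - K') := by
      ext S
      simp [inner_sub_left]
    rw [Real.dist_eq, dist_eq_norm]
    refine (abs_norm_sub_norm_le (toDualV ι K) (toDualV ι K')).trans ?_
    rw [e]
    exact hle _
  have h : MemLp (fun t => ‖toDualV ι (Q t)‖) 2 (volume.restrict (Icc 0 T)) := by
    refine hQ.of_le_mul (c := ‖inclHS ι‖) (hc.comp_aestronglyMeasurable hQ.1)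
      (Filter.Eventually.of_forall fun t => ?_)
    exact (Real.norm_of_nonneg (ContinuousLinearMap.opNorm_nonneg _)).trans_le (hle (Q t))
  exact h.integrable_sq

/-- Young's inequality applied at each `t`, before integrating, so that the squared dual norm of `Q
t` appears under the integral. The term `m τ ‖P‖²` takes half of the coercive term of the doubled
step estimate. -/
theorem stepSize_mul_inner_meanRhs_le {ι : V →L[ℝ] H} (hT : 0 < T) {Q : ℝ → HS H H}
    (hQ : MemLp Q 2 (volume.restrict (Icc 0 T))) {m : ℝ} (hm : 0 < m) (n : Fin N) (P : opV ι) :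
    2 * (stepSize T N * ⟪meanRhs T N Q n, inclHS ι P⟫_ℝ) ≤ m * (stepSize T N * ‖P‖ ^ 2)
      + 1 / m * ∫ t in gridPoint T N n..gridPoint T N (n + 1), ‖toDualV ι (Q t)‖ ^ 2 := by
  have hQi : IntegrableOn Q (Icc 0 T) := hQ.integrable (by norm_num)
  have hQd := integrableOn_norm_toDualV_sq (ι := ι) hQ
  have hτ := stepSize_pos hT n
  have e := map_meanRhs hT hQi n (innerSL ℝ (inclHS ι P))
  simp only [innerSL_apply_apply] at e
  have h1 : IntervalIntegrable (fun t => ⟪inclHS ι P, Q t⟫_ℝ) volume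
      (gridPoint T N n) (gridPoint T N (n + 1)) :=
    intervalIntegrable_grid hT ((innerSL ℝ (inclHS ι P)).integrable_comp hQi) n
  have h2 := intervalIntegrable_grid hT hQd n
  have h3 := intervalIntegral.integral_mono_on (gridPoint_le hT N n) (h1.const_mul 2)
    ((intervalIntegrable_const (c := m * ‖P‖ ^ 2)).add (h2.const_mul (1 / m))) (fun t _ => by
      have h4 : ⟪inclHS ι P, Q t⟫_ℝ ≤ ‖toDualV ι (Q t)‖ * ‖P‖ := by
        rw [real_inner_comm, ← toDualV_apply]
        exact (le_abs_self _).trans ((toDualV ι (Q t)).le_opNorm P)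
      set x := ‖toDualV ι (Q t)‖
      set y := ‖P‖
      have h5 : 0 ≤ m * y ^ 2 + 1 / m * x ^ 2 - 2 * (x * y) := by
        have : m * y ^ 2 + 1 / m * x ^ 2 - 2 * (x * y) = 1 / m * (m * y - x) ^ 2 := by
          field_simp; ring
        rw [this]; positivity
      change 2 * ⟪inclHS ι P, Q t⟫_ℝ ≤ m * y ^ 2 + 1 / m * x ^ 2
      linarith)
  rw [intervalIntegral.integral_const_mul, intervalIntegral.integral_add
    intervalIntegrable_const (h2.const_mul _), intervalIntegral.integral_const, gridPoint_sub,
    intervalIntegral.integral_const_mul, smul_eq_mul] at h3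
  rw [real_inner_comm, e, mul_inv_cancel_left₀ hτ.ne']
  linarith

/-- Every step of a scheme whose solvability is known for all admissible previous values can be
carried out successively. -/
theorem exists_iterates {ι : V →L[ℝ] H} {s : Set (HS H H)} (h0 : (0 : HS H H) ∈ s)
    {p : Fin N → HS H H → opV ι → Prop}
    (hp : ∀ n, ∀ K ∈ s, ∃ P, p n K P ∧ inclHS ι P ∈ s) {P0 : HS H H} (hP0 : P0 ∈ s) :
    ∃ P : ℕ → opV ι, (∀ n, iterates P0 P n ∈ s) ∧
      ∀ n : Fin N, p n (iterates P0 P n) (P (n + 1)) := by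
  have hstep : ∀ (n : ℕ) (K : s), ∃ P : opV ι, (∀ h : n < N, p ⟨n, h⟩ K P) ∧ inclHS ι P ∈ s := by
    intro n K
    by_cases h : n < N
    · obtain ⟨P, h1, h2⟩ := hp ⟨n, h⟩ K K.2
      exact ⟨P, fun _ => h1, h2⟩
    -- Beyond the last grid point the sequence is continued by zero.
    · exact ⟨0, fun h' => absurd h' h, by rwa [map_zero]⟩
  choose g hg1 hg2 using hstep
  let x : ℕ → s := fun n => Nat.rec ⟨P0, hP0⟩ (fun n K => ⟨inclHS ι (g n K), hg2 n K⟩) n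
  -- The value at index 0 is arbitrary, since `iterates` starts with `P0`; index `n + 1` holds the
  -- result of step `n`.
  let P : ℕ → opV ι := fun n => Nat.rec 0 (fun n _ => g n (x n)) n
  have hx : ∀ n, iterates P0 P n = (x n).1 := fun n => by cases n <;> rfl
  refine ⟨P, fun n => ?_, fun n => ?_⟩
  · rw [hx]; exact (x n).2
  · rw [hx]; exact hg1 n (x n) n.2

/-- The energy estimate: summation of the estimates for the single steps. -/
theorem energy_sum {ι : V →L[ℝ] H} {P0 : HS H H} {P : ℕ → opV ι} {q : ℝ → ℝ} (hT : 0 < T)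
    (hq : IntegrableOn q (Icc 0 T)) {m b : ℝ}
    (h : ∀ n : Fin N, ‖iterates P0 P (n + 1)‖ ^ 2
        + ‖iterates P0 P (n + 1) - iterates P0 P n‖ ^ 2 + m * (stepSize T N * ‖P (n + 1)‖ ^ 2)
      ≤ ‖iterates P0 P n‖ ^ 2 + b * ∫ t in gridPoint T N n..gridPoint T N (n + 1), q t)
    (n : ℕ) (hn : n ≤ N) :
    ‖iterates P0 P n‖ ^ 2
        + ∑ k ∈ Finset.Icc 1 n, ‖iterates P0 P k - iterates P0 P (k - 1)‖ ^ 2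
        + m * (stepSize T N * ∑ k ∈ Finset.Icc 1 n, ‖P k‖ ^ 2)
      ≤ ‖P0‖ ^ 2 + b * ∫ t in (0 : ℝ)..gridPoint T N n, q t := by
  induction n with
  | zero => simp [gridPoint, iterates]
  | succ n ih =>
    have h1 := ih (by omega)
    have h2 := h ⟨n, hn⟩
    rw [Finset.sum_Icc_succ_top (by omega), Finset.sum_Icc_succ_top (by omega),
      Nat.add_sub_cancel]
    have hg : gridPoint T N (n + 1) ≤ T := (grid_subset hT ⟨n, hn⟩
      (right_mem_Icc.2 (gridPoint_le hT N n))).2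
    have hg0 : 0 ≤ gridPoint T N n := (grid_subset hT ⟨n, hn⟩
      (left_mem_Icc.2 (gridPoint_le hT N n))).1
    have h3 : IntervalIntegrable q volume 0 (gridPoint T N n) := by
      rw [intervalIntegrable_iff_integrableOn_Icc_of_le hg0]
      exact hq.mono_set (Icc_subset_Icc_right ((gridPoint_le hT N n).trans hg))
    have h4 := intervalIntegral.integral_add_adjacent_intervals h3
      (intervalIntegrable_grid hT hq ⟨n, hn⟩)
    simp only at h2 h4
    rw [← h4]
    nlinarith

end Means

end Riccati

/-! ### Solvability and energy estimate on the whole grid. -/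

theorem mainTheorem4 {V H : Type*}
    [NormedAddCommGroup V] [InnerProductSpace ℝ V] [CompleteSpace V]
    [TopologicalSpace.SeparableSpace V]
    [NormedAddCommGroup H] [InnerProductSpace ℝ H] [CompleteSpace H]
    [TopologicalSpace.SeparableSpace H]
    (ι : V →L[ℝ] H) (hι : Riccati.IsCompactDenseEmbedding ι)
    (C : ℝ) (hC : 0 < C) (hιC : ∀ v : V, ‖ι v‖ ≤ C * ‖v‖)
    (T : ℝ) (hT : 0 < T) (μ η : ℝ) (a : ℝ → V →ₗ[ℝ] V →ₗ[ℝ] ℝ)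
    (ha : Riccati.IsUniformForm T μ η a)
    (N : ℕ) (hN : 1 ≤ N) (hτ : Riccati.stepSize T N < μ / (2 * C ^ 2))
    (γ : ℝ) (hγ : 0 ≤ γ) (hγμ : γ < μ / C ^ 2)
    (Q : ℝ → Riccati.HS H H) (hQ : MemLp Q 2 (volume.restrict (Icc 0 T)))
    (hQγ : ∀ᵐ t ∂(volume.restrict (Icc 0 T)), Q t ∈ Riccati.lowerBounded H (-γ ^ 2))
    (P0 : Riccati.HS H H) (hP0 : P0 ∈ Riccati.lowerBounded H (-γ)) :
    ∃ P : ℕ → Riccati.opV ι,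
      (∀ n : Fin N,
        Riccati.IsEulerStep ι (Riccati.stepSize T N) (Riccati.meanOperator ha hT n)
          (Riccati.meanRhs T N Q n) (Riccati.iterates P0 P n) (P (n + 1))) ∧
      (∀ n ∈ Finset.Icc 1 N, Riccati.inclHS ι (P n) ∈ Riccati.lowerBounded H (-γ)) ∧
      (∀ n ∈ Finset.Icc 1 N,
        ‖Riccati.inclHS ι (P n)‖ ^ 2
          + ∑ k ∈ Finset.Icc 1 n,
              ‖Riccati.iterates P0 P k - Riccati.iterates P0 P (k - 1)‖ ^ 2
          + (μ - γ * C ^ 2 / 2)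
              * (Riccati.stepSize T N * ∑ k ∈ Finset.Icc 1 n, ‖P k‖ ^ 2)
        ≤ ‖P0‖ ^ 2
          + 1 / (μ - γ * C ^ 2 / 2) * ∫ t in (0 : ℝ)..T, ‖Riccati.toDualV ι (Q t)‖ ^ 2) := by
  have hμ : 0 < μ := ha.mu_pos
  have hγC : γ * C ^ 2 < μ := by rwa [lt_div_iff₀ (by positivity)] at hγμ
  have hm : 0 < μ - γ * C ^ 2 / 2 := by linarith
  have hQi : IntegrableOn Q (Icc 0 T) := hQ.integrable (by norm_num)
  have hQd := Riccati.integrableOn_norm_toDualV_sq (ι := ι) hQ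
  have h0 : (0 : Riccati.HS H H) ∈ Riccati.lowerBounded H (-γ) := by
    rw [Riccati.mem_lowerBounded_iff]
    exact ⟨fun u v => by simp, fun u => by simp; positivity⟩
  obtain ⟨P, hPmem, hP⟩ := Riccati.exists_iterates h0 (p := fun (n : Fin N) K P =>
      Riccati.IsEulerStep ι (Riccati.stepSize T N) (Riccati.meanOperator ha hT n)
        (Riccati.meanRhs T N Q n) K P ∧
      (Riccati.stepSize T N)⁻¹ * ⟪Riccati.inclHS ι P - K, Riccati.inclHS ι P⟫_ℝ
          + (μ - γ * C ^ 2 / 2) * ‖P‖ ^ 2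
        ≤ ⟪Riccati.meanRhs T N Q n, Riccati.inclHS ι P⟫_ℝ) (fun n K hK => by
    obtain ⟨P, h1, h2, h3⟩ := Riccati.exists_eulerStep hι.compact hC hιC hμ
      (Riccati.meanOperator_coercive ha hT n) (Riccati.stepSize_pos hT n) hγ hγμ
      (Riccati.meanRhs_mem_lowerBounded hT hQi hQγ n) hK
    exact ⟨P, ⟨h1, h3⟩, h2⟩) hP0
  refine ⟨P, fun n => (hP n).1, fun n hn => ?_, fun n hn => ?_⟩
  all_goals obtain ⟨h1, hnN⟩ := Finset.mem_Icc.1 hn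
  all_goals obtain ⟨n, rfl⟩ := Nat.exists_eq_succ_of_ne_zero (by omega : n ≠ 0)
  · exact hPmem (n + 1)
  · refine (Riccati.energy_sum (b := 1 / (μ - γ * C ^ 2 / 2)) hT hQd
        (fun k => ?_) (n + 1) hnN).trans ?_
    · have h2 := Riccati.stepSize_mul_inner_meanRhs_le hT hQ hm k (P (k + 1))
      have hτ0 := Riccati.stepSize_pos hT k
      have h3 := mul_le_mul_of_nonneg_left (hP k).2 hτ0.le
      rw [mul_add, mul_inv_cancel_left₀ hτ0.ne'] at h3
      change ‖Riccati.inclHS ι (P (k + 1))‖ ^ 2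
        + ‖Riccati.inclHS ι (P (k + 1)) - Riccati.iterates P0 P k‖ ^ 2 + _ ≤ _
      set K := Riccati.inclHS ι (P (k + 1))
      set K' := Riccati.iterates P0 P k
      -- This identity turns the difference quotient, tested with `K`, into a telescoping part and
      -- the squared increment.
      have h4 : 2 * ⟪K - K', K⟫_ℝ = ‖K‖ ^ 2 - ‖K'‖ ^ 2 + ‖K - K'‖ ^ 2 := by
        rw [norm_sub_sq_real, inner_sub_left, real_inner_self_eq_norm_sq, real_inner_comm K K']
        ring
      linarith
    · have hg : Riccati.gridPoint T N (n + 1) ≤ T := (Riccati.grid_subset hT ⟨n, hnN⟩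
        (right_mem_Icc.2 (Riccati.gridPoint_le hT N n))).2
      have hg0 : 0 ≤ Riccati.gridPoint T N (n + 1) := (Riccati.grid_subset hT ⟨n, hnN⟩
        (right_mem_Icc.2 (Riccati.gridPoint_le hT N n))).1
      -- The summed estimate only reaches the current grid point; the integrand is nonnegative, so
      -- the integral may be extended to `T`.
      have h2 := intervalIntegral.integral_mono_interval le_rfl hg0 hg
        (Filter.Eventually.of_forall fun t => sq_nonneg ‖Riccati.toDualV ι (Q t)‖)
        ((intervalIntegrable_iff_integrableOn_Icc_of_le hT.le).2 hQd)
      have h3 := mul_le_mul_of_nonneg_left h2 (one_div_pos.2 hm).le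
      linarith
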